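/- Let $\mathbb{A}$ be a finite abelian group with $d=|\mathbb{A}|$ elements, identified with $\{0,1,\dots,d-1\}$ by an arbitrary bijection under which the neutral element corresponds to $0$. Let $\mathbb{G}$ be the group of all sequences $(a_k)_{k\in\mathbb{Z}}$ in $\mathbb{A}$ that vanish for all sufficiently large $k$, with coordinatewise addition, let $\mathbb{R}_+=[0,\infty)$, and put $$\iota:\mathbb{G}\to\mathbb{R}_+,\quad \iota\big((a_k)_k\big)=\sum_{k\in\mathbb{Z}}a_kd^k,\qquad \kappa:\mathbb{R}_+\to\mathbb{G},\quad \kappa(t)=\big(\lfloor d^{-k}t\rfloor \bmod d\big)_{k\in\mathbb{Z}},\qquad x\oplus y:=\iota\big(\kappa(x)+\kappa(y)\big)\quad(x,y\in\mathbb{R}_+).$$ For bounded Borel functions $F,G:\mathbb{R}_+^2\to\mathbb{C}$, each supported in a bounded rectangle, and $k\in\mathbb{Z}$, let $$\mathrm{A}_k(F,G)(x,y):=d^k\int_{[0,d^{-k})}F(x\oplus t,y)\,G(x,y\oplus t)\,dt .$$ **Proposition.** For every real $p$ with $2\le p<\infty$ there is a finite constant $C_p$, depending only on $p$ (and not on $\mathbb{A}$,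 the identification, $F$, $G$, $m$ or the $k_j$), such that for all $\mathbb{A},F,G$ as above, every positive integer $m$ and all integers $k_0<k_1<\cdots<k_m$, $$\sum_{j=0}^{m-1}\big\|\mathrm{A}_{k_{j+1}}(F,G)-\mathrm{A}_{k_j}(F,G)\big\|_{L^p(\mathbb{R}_+^2)}^p\le C_p\,\|F\|_{L^{2p}(\mathbb{R}_+^2)}^p\,\|G\|_{L^{2p}(\mathbb{R}_+^2)}^p,$$ where the norms are taken with respect to Lebesgue measure on $\mathbb{R}_+^2$. -/

import Mathlib

open MeasureTheory
open scoped NNReal ENNReal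

noncomputable section

/-- Lebesgue measure on the half-line `[0, ∞)`. -/
def halfLineVolume : Measure ℝ≥0 :=
  (volume : Measure ℝ).comap ((↑) : ℝ≥0 → ℝ)

instance sigmaFinite_halfLineVolume : SigmaFinite halfLineVolume := by
  have he : MeasurableEmbedding ((↑) : ℝ≥0 → ℝ) :=
    MeasurableEmbedding.subtype_coe measurableSet_Ici
  refine SigmaFinite.of_map _ he.measurable.aemeasurable ?_
  rw [halfLineVolume, he.map_comap]
  infer_instance

/-- Lebesgue measure on the quarter-plane `[0, ∞)²`. -/
def quarterPlaneVolume : Measure (ℝ≥0 × ℝ≥0) :=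
  halfLineVolume.prod halfLineVolume

/-- An identification of a finite abelian group `A` with the digits `{0, 1, …, d - 1}`,
`d = |A|`, arbitrary except that the neutral element corresponds to the digit `0`. -/
structure DigitLabelling (A : Type*) [AddCommGroup A] [Finite A] where
  toEquiv : A ≃ Fin (Nat.card A)
  map_zero : (toEquiv 0 : ℕ) = 0

namespace CantorGroup

variable (A : Type*) [AddCommGroup A]

/-- The group `𝔾` of two-sided sequences in `A` that vanish at all large indices,
with coordinatewise addition. -/
def seqGroup : AddSubgroup (ℤ → A) where
  carrier := {a | ∃ k₀ : ℤ, ∀ k, k₀ < k → a k = 0}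
  zero_mem' := ⟨0, fun _ _ => rfl⟩
  add_mem' := by
    rintro a b ⟨k₀, ha⟩ ⟨l₀, hb⟩
    refine ⟨max k₀ l₀, fun k hk => ?_⟩
    rw [Pi.add_apply, ha k (lt_of_le_of_lt (le_max_left _ _) hk),
      hb k (lt_of_le_of_lt (le_max_right _ _) hk), add_zero]
  neg_mem' := by
    rintro a ⟨k₀, ha⟩
    exact ⟨k₀, fun k hk => by rw [Pi.neg_apply, ha k hk, neg_zero]⟩

variable {A} [Finite A]

/-- `ι (a) = ∑_k a_k d^k`. -/
def iota (e : DigitLabelling A) (a : seqGroup A) : ℝ≥0 :=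
  ∑' k : ℤ, (((e.toEquiv ((a : ℤ → A) k) : ℕ) : ℝ≥0)) * (Nat.card A : ℝ≥0) ^ k

/-- The element of `A` labelled by the `k`-th digit `⌊d^{-k} t⌋ mod d` of `t`. -/
def digit (e : DigitLabelling A) (t : ℝ≥0) (k : ℤ) : A :=
  e.toEquiv.symm
    ⟨⌊(Nat.card A : ℝ≥0) ^ (-k) * t⌋₊ % Nat.card A, Nat.mod_lt _ Nat.card_pos⟩

theorem digit_eq_zero_of_mod_eq_zero (e : DigitLabelling A) (t : ℝ≥0) (k : ℤ)
    (h : ⌊(Nat.card A : ℝ≥0) ^ (-k) * t⌋₊ % Nat.card A = 0) : digit e t k = 0 := by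
  rw [digit, Equiv.symm_apply_eq]
  ext
  rw [e.map_zero]
  exact h

theorem digit_mem_seqGroup (e : DigitLabelling A) (t : ℝ≥0) : digit e t ∈ seqGroup A := by
  rcases (Nat.one_le_iff_ne_zero.mpr (Nat.card_pos (α := A)).ne').eq_or_lt with h | h
  · exact ⟨0, fun k _ => digit_eq_zero_of_mod_eq_zero e t k (by rw [← h]; exact Nat.mod_one _)⟩
  · have h1 : (1 : ℝ≥0) < (Nat.card A : ℝ≥0) := by exact_mod_cast h
    obtain ⟨n, hn⟩ := pow_unbounded_of_one_lt t h1
    refine ⟨n, fun k hk => digit_eq_zero_of_mod_eq_zero e t k ?_⟩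
    have h2 : t < (Nat.card A : ℝ≥0) ^ k := by
      refine hn.trans_le ?_
      rw [← zpow_natCast]
      exact zpow_le_zpow_right₀ h1.le hk.le
    have h3 : (Nat.card A : ℝ≥0) ^ (-k) * t < 1 := by
      rw [zpow_neg, ← div_eq_inv_mul]
      exact (div_lt_one (lt_of_le_of_lt (zero_le) h2)).mpr h2
    rw [Nat.floor_eq_zero.mpr h3, Nat.zero_mod]

/-- `κ (t) = (⌊d^{-k} t⌋ mod d)_k`. -/
def kappa (e : DigitLabelling A) (t : ℝ≥0) : seqGroup A :=
  ⟨digit e t, digit_mem_seqGroup e t⟩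

/-- Digitwise addition `x ⊕ y = ι (κ (x) + κ (y))`. -/
def oplus (e : DigitLabelling A) (x y : ℝ≥0) : ℝ≥0 :=
  iota e (kappa e x + kappa e y)

/-- `A_k(F, G)(x, y) = d^k ∫_{[0, d^{-k})} F(x ⊕ t, y) G(x, y ⊕ t) dt`. -/
def bilinearAverage (e : DigitLabelling A) (k : ℤ) (F G : ℝ≥0 × ℝ≥0 → ℂ) (z : ℝ≥0 × ℝ≥0) : ℂ :=
  (Nat.card A : ℂ) ^ k *
    ∫ t in Set.Ico (0 : ℝ≥0) ((Nat.card A : ℝ≥0) ^ (-k)),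
      F (oplus e z.1 t, z.2) * G (z.1, oplus e z.2 t) ∂halfLineVolume

end CantorGroup

end

/-! The identity is first proved for a finite abelian group in place of the half-line. Put `z = x +
y + t`: the average over a subgroup `K` becomes an average of `f (y, z) * g (x, z)` over `z ∈ x + y
+ K`. For `K ≤ L`, the squared `ℓ²` norm of `A_K - A_L` is a difference of energies minus twice a
cross term. The cross term contains the kernel `ψ = φ_K - φ_L`, the difference of two uniform
densities. As `K` and `L` are nested, `ψ` is an even convolution idempotent, so Cauchy–Schwarz
separates `f` from `g` and bounds the cross term by box forms of `f` alone and of `g` alone.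
Positivity of these forms turns them into differences of one quantity at `K` and at `L`
(`boxForm_sub_le`). Everything telescopes along a chain, which gives an `ℓ⁴ × ℓ⁴ → ℓ²` bound
independent of the group and of the chain (`sum_triAverage_variation_sq_le`).

The trivial `ℓ^∞` bound and the three lines theorem extend this to exponent `p ≥ 2` with constant `2
^ (p - 2) * 3` (`sum_norm_rpow_le_of_interpolation`).

On `[0, dⁿ)`, keeping only the digits at positions `-n, …, n - 1` gives a finite group. Outside a
null set of `t`, where carries could occur, `⊕` respects these blocks, and `[0, d⁻ᵏ)` corresponds to
a subgroup that shrinks as `k` grows. Hence the averages of step functions are exactly the finite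
averages (`bilinearAverage_stepFun`). General `F` and `G` are almost everywhere limits of bounded
step functions by martingale convergence. The averages converge too, because digitwise translation
preserves measure, and Fatou's lemma concludes (`lintegral_variation_le`). -/

noncomputable section

/-! ### Finite abelian groups: idempotent kernels and box forms. -/

namespace FiniteGroupAverages

open Finset ComplexConjugate

variable {H : Type*} [AddCommGroup H]

open Classical in
/-- The density of the uniform probability measure on a subgroup. -/
def uniformDensity (K : AddSubgroup H) (a : H) : ℝ :=
  if a ∈ K then (Nat.card K : ℝ)⁻¹ else 0

lemma uniformDensity_nonneg (K : AddSubgroup H) (a : H) : 0 ≤ uniformDensity K a := by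
  unfold uniformDensity
  split_ifs <;> positivity

lemma uniformDensity_neg (K : AddSubgroup H) (a : H) :
    uniformDensity K (-a) = uniformDensity K a := by
  unfold uniformDensity
  split_ifs <;> simp_all

/-- On the support of the first factor, `a ∈ K ≤ L`, so translating by `a` does not change
membership in `L`. -/
lemma uniformDensity_mul_of_le {K L : AddSubgroup H} (h : K ≤ L) (a b : H) :
    uniformDensity K a * uniformDensity L b
      = uniformDensity K a * uniformDensity L (b - a) := by
  by_cases ha : a ∈ K
  · have : b - a ∈ L ↔ b ∈ L := by
      rw [sub_eq_add_neg, L.add_mem_cancel_right (L.neg_mem (h ha))]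
    unfold uniformDensity
    split_ifs <;> simp_all
  · simp [uniformDensity, ha]

variable [Fintype H]

lemma sum_uniformDensity (K : AddSubgroup H) : ∑ a, uniformDensity K a = 1 := by
  classical
  have h0 : (Nat.card K : ℝ) ≠ 0 := by exact_mod_cast (Nat.card_pos (α := K)).ne'
  simp only [uniformDensity]
  rw [← Finset.sum_filter, Finset.sum_const, nsmul_eq_mul, ← Fintype.card_subtype,
    ← Nat.card_eq_fintype_card]
  exact mul_inv_cancel₀ h0

lemma sum_uniformDensity_sub_right (K : AddSubgroup H) (b : H) :
    ∑ a, uniformDensity K (a - b) = 1 := by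
  rw [← sum_uniformDensity K]
  exact Equiv.sum_comp (Equiv.subRight b) _

lemma sum_uniformDensity_sub_left (K : AddSubgroup H) (b : H) :
    ∑ a, uniformDensity K (b - a) = 1 := by
  rw [← sum_uniformDensity K]
  exact Equiv.sum_comp (Equiv.subLeft b) _

lemma uniformDensity_conv_of_le {K L : AddSubgroup H} (h : K ≤ L) (a b : H) :
    ∑ s, uniformDensity K (a - s) * uniformDensity L (s - b) = uniformDensity L (a - b) := by
  have h1 : ∀ s, uniformDensity K (a - s) * uniformDensity L (s - b)
      = uniformDensity K (a - s) * uniformDensity L (a - b) := fun s => by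
    rw [uniformDensity_mul_of_le h (a - s) (a - b), show a - b - (a - s) = s - b by abel]
  simp_rw [h1]
  rw [← Finset.sum_mul, sum_uniformDensity_sub_left, one_mul]

/-- Real, even functions that are idempotent under convolution. -/
structure EvenIdempotent (ψ : H → ℝ) : Prop where
  even : ∀ a, ψ (-a) = ψ a
  conv : ∀ a b, ∑ s, ψ (a - s) * ψ (s - b) = ψ (a - b)

lemma evenIdempotent_uniformDensity (K : AddSubgroup H) : EvenIdempotent (uniformDensity K) :=
  ⟨uniformDensity_neg K, uniformDensity_conv_of_le le_rfl⟩

/-- Convolution with a uniform density is the projection onto invariant functions. For nested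
subgroups the projections commute and their difference is again a projection. -/
lemma evenIdempotent_sub {K L : AddSubgroup H} (h : K ≤ L) :
    EvenIdempotent (uniformDensity K - uniformDensity L) := by
  refine ⟨fun a => by simp [uniformDensity_neg], fun a b => ?_⟩
  have h2 : ∑ s, uniformDensity L (a - s) * uniformDensity K (s - b)
      = uniformDensity L (a - b) := by
    rw [← neg_sub, uniformDensity_neg, ← uniformDensity_conv_of_le h b a]
    refine Finset.sum_congr rfl fun s _ => ?_
    rw [← neg_sub, uniformDensity_neg, ← neg_sub b s, uniformDensity_neg, mul_comm]
  simp only [Pi.sub_apply, sub_mul, mul_sub, Finset.sum_sub_distrib, h2,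
    uniformDensity_conv_of_le h, uniformDensity_conv_of_le (le_refl K),
    uniformDensity_conv_of_le (le_refl L)]
  ring

/-- The squared `ℓ²` norm of the convolution `ψ * u`. -/
def convEnergy (ψ : H → ℝ) (u : H → ℂ) : ℝ := ∑ s, ‖∑ y, (ψ (s - y) : ℂ) * u y‖ ^ 2

lemma convEnergy_nonneg (ψ : H → ℝ) (u : H → ℂ) : 0 ≤ convEnergy ψ u :=
  Finset.sum_nonneg fun _ _ => by positivity

lemma EvenIdempotent.convEnergy_eq {ψ : H → ℝ} (hψ : EvenIdempotent ψ) (u : H → ℂ) :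
    (convEnergy ψ u : ℂ) = ∑ y, ∑ y', (ψ (y - y') : ℂ) * (u y * conj (u y')) := by
  have h1 : ∀ s, ((‖∑ y, (ψ (s - y) : ℂ) * u y‖ ^ 2 : ℝ) : ℂ)
      = ∑ y, ∑ y', ((ψ (y - s) * ψ (s - y') : ℝ) : ℂ) * (u y * conj (u y')) := fun s => by
    rw [Complex.ofReal_pow, ← Complex.mul_conj', map_sum, Finset.sum_mul_sum]
    refine Finset.sum_congr rfl fun y _ => Finset.sum_congr rfl fun y' _ => ?_
    rw [← hψ.even (s - y), neg_sub]
    simp only [map_mul, Complex.conj_ofReal, Complex.ofReal_mul]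
    ring
  rw [convEnergy, Complex.ofReal_sum]
  simp_rw [h1]
  rw [Finset.sum_comm]
  refine Finset.sum_congr rfl fun y _ => ?_
  rw [Finset.sum_comm]
  refine Finset.sum_congr rfl fun y' _ => ?_
  rw [← Finset.sum_mul, ← Complex.ofReal_sum, hψ.conv]

/-- Writing `ψ = ψ * ψ` splits the double sum into a pairing of `ψ * u` with a reflected translate
of `ψ * v`. The reflection `s ↦ z - s` does not affect the energy, so the bound is uniform in `z`.
-/
lemma EvenIdempotent.norm_sum_le {ψ : H → ℝ} (hψ : EvenIdempotent ψ) (u v : H → ℂ) (z : H) :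
    ‖∑ x, ∑ y, (ψ (z - x - y) : ℂ) * (u y * v x)‖ ≤ (convEnergy ψ u + convEnergy ψ v) / 2 := by
  have h1 : ∑ x, ∑ y, (ψ (z - x - y) : ℂ) * (u y * v x)
      = ∑ s, (∑ y, (ψ (s - y) : ℂ) * u y) * (∑ x, (ψ (z - s - x) : ℂ) * v x) := by
    simp_rw [Finset.sum_mul_sum]
    conv_rhs => rw [Finset.sum_comm]; enter [2, y]; rw [Finset.sum_comm]
    rw [Finset.sum_comm]
    refine Finset.sum_congr rfl fun y _ => Finset.sum_congr rfl fun x _ => ?_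
    rw [← hψ.conv, Complex.ofReal_sum, Finset.sum_mul]
    refine Finset.sum_congr rfl fun s _ => ?_
    rw [Complex.ofReal_mul, show z - x - s = z - s - x by abel]
    ring
  rw [h1]
  refine (_root_.norm_sum_le _ _).trans ?_
  have h2 : convEnergy ψ v = ∑ s, ‖∑ x, (ψ (z - s - x) : ℂ) * v x‖ ^ 2 :=
    (Equiv.sum_comp (Equiv.subLeft z) (fun s => ‖∑ x, (ψ (s - x) : ℂ) * v x‖ ^ 2)).symm
  rw [h2, convEnergy, ← Finset.sum_add_distrib, Finset.sum_div]
  refine Finset.sum_le_sum fun s _ => ?_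
  rw [norm_mul]
  nlinarith [sq_nonneg (‖∑ y, (ψ (s - y) : ℂ) * u y‖ - ‖∑ x, (ψ (z - s - x) : ℂ) * v x‖)]

lemma sum_comm_pairs {H : Type*} [Fintype H] (T : H → H → H → H → ℂ) :
    ∑ z, ∑ z', ∑ y, ∑ y', T z z' y y' = ∑ y, ∑ y', ∑ z, ∑ z', T z z' y y' := by
  calc _ = ∑ p : H × H, ∑ q : H × H, T p.1 p.2 q.1 q.2 := by
        simp only [Fintype.sum_prod_type]
    _ = ∑ q : H × H, ∑ p : H × H, T p.1 p.2 q.1 q.2 := Finset.sum_comm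
    _ = _ := by simp only [Fintype.sum_prod_type]

/-- The quadrilinear box form of `f` with kernels `a` and `b`. -/
def boxForm (f : H → H → ℂ) (a b : H → ℝ) : ℝ :=
  (∑ z, ∑ z', ∑ y, ∑ y', (a (z - z') : ℂ) * ((b (y - y') : ℂ) *
    (f y z * conj (f y z') * conj (f y' z * conj (f y' z'))))).re

/-- Together with `boxForm_left`, this exhibits positivity: the form is nonnegative as soon as one
kernel is an even idempotent and the other is nonnegative. -/
lemma EvenIdempotent.boxForm_right {b : H → ℝ} (hb : EvenIdempotent b) (f : H → H → ℂ)
    (a : H → ℝ) :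
    boxForm f a b = ∑ z, ∑ z', a (z - z') * convEnergy b (fun y => f y z * conj (f y z')) := by
  rw [boxForm, ← Complex.ofReal_re (∑ z, ∑ z', _)]
  congr 1
  simp only [Complex.ofReal_sum, Complex.ofReal_mul, hb.convEnergy_eq, Finset.mul_sum]

lemma EvenIdempotent.boxForm_left {a : H → ℝ} (ha : EvenIdempotent a) (f : H → H → ℂ)
    (b : H → ℝ) :
    boxForm f a b = ∑ y, ∑ y', b (y - y') * convEnergy a (fun z => f y z * conj (f y' z)) := by
  rw [boxForm, ← Complex.ofReal_re (∑ y, ∑ y', _)]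
  congr 1
  simp only [Complex.ofReal_sum, Complex.ofReal_mul, ha.convEnergy_eq, Finset.mul_sum]
  rw [sum_comm_pairs]
  refine Finset.sum_congr rfl fun y _ => Finset.sum_congr rfl fun y' _ =>
    Finset.sum_congr rfl fun z _ => Finset.sum_congr rfl fun z' _ => ?_
  simp only [map_mul, Complex.conj_conj]
  ring

lemma boxForm_sub_left (f : H → H → ℂ) (a a' b : H → ℝ) :
    boxForm f (a - a') b = boxForm f a b - boxForm f a' b := by
  simp only [boxForm, ← Complex.sub_re, ← Finset.sum_sub_distrib, Pi.sub_apply,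
    Complex.ofReal_sub, sub_mul]

lemma boxForm_sub_right (f : H → H → ℂ) (a b b' : H → ℝ) :
    boxForm f a (b - b') = boxForm f a b - boxForm f a b' := by
  simp only [boxForm, ← Complex.sub_re, ← Finset.sum_sub_distrib, Pi.sub_apply,
    Complex.ofReal_sub, sub_mul, mul_sub]

lemma boxForm_uniformDensity_nonneg (f : H → H → ℂ) (K : AddSubgroup H) :
    0 ≤ boxForm f (uniformDensity K) (uniformDensity K) := by
  rw [(evenIdempotent_uniformDensity K).boxForm_right]
  exact Finset.sum_nonneg fun z _ => Finset.sum_nonneg fun z' _ =>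
    mul_nonneg (uniformDensity_nonneg _ _) (convEnergy_nonneg _ _)

/-- The right side minus the left side is the form with kernels `φ_K - φ_L` and `φ_K`, where the
first is idempotent and the second nonnegative. -/
lemma boxForm_sub_le {K L : AddSubgroup H} (h : K ≤ L) (f : H → H → ℂ) :
    boxForm f (uniformDensity L) (uniformDensity K - uniformDensity L)
      ≤ boxForm f (uniformDensity K) (uniformDensity K)
        - boxForm f (uniformDensity L) (uniformDensity L) := by
  have h1 : 0 ≤ boxForm f (uniformDensity K - uniformDensity L) (uniformDensity K) := by
    rw [(evenIdempotent_sub h).boxForm_left]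
    exact Finset.sum_nonneg fun z _ => Finset.sum_nonneg fun z' _ =>
      mul_nonneg (uniformDensity_nonneg _ _) (convEnergy_nonneg _ _)
  rw [boxForm_sub_left] at h1
  rw [boxForm_sub_right]
  linarith

lemma mul_four_le (a b c d : ℝ) : a * b * (c * d) ≤ (a ^ 4 + b ^ 4 + c ^ 4 + d ^ 4) / 4 := by
  nlinarith [sq_nonneg (a * b - c * d), sq_nonneg (a ^ 2 - b ^ 2), sq_nonneg (c ^ 2 - d ^ 2)]

/-- The four factors are separated by the arithmetic-geometric mean inequality. In each resulting
term the kernels sum to one over the two variables that no longer occur. -/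
lemma boxForm_uniformDensity_le (f : H → H → ℂ) (K : AddSubgroup H) :
    boxForm f (uniformDensity K) (uniformDensity K) ≤ ∑ y, ∑ z, ‖f y z‖ ^ 4 := by
  set φ := uniformDensity K with hφ
  have h1 : boxForm f φ φ ≤ ∑ z, ∑ z', ∑ y, ∑ y', φ (z - z') * (φ (y - y') *
      ((‖f y z‖ ^ 4 + ‖f y z'‖ ^ 4 + ‖f y' z‖ ^ 4 + ‖f y' z'‖ ^ 4) / 4)) := by
    simp only [boxForm, Complex.re_sum]
    refine Finset.sum_le_sum fun z _ => Finset.sum_le_sum fun z' _ => Finset.sum_le_sum fun y _ =>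
      Finset.sum_le_sum fun y' _ => ?_
    rw [Complex.re_ofReal_mul, Complex.re_ofReal_mul]
    refine mul_le_mul_of_nonneg_left (mul_le_mul_of_nonneg_left ?_ (uniformDensity_nonneg _ _))
      (uniformDensity_nonneg _ _)
    refine (Complex.re_le_norm _).trans ?_
    simp only [norm_mul, map_mul, RCLike.norm_conj]
    exact mul_four_le _ _ _ _
  refine h1.trans (le_of_eq ?_)
  have hr : ∀ b, ∑ a, φ (a - b) = 1 := sum_uniformDensity_sub_right K
  have hl : ∀ b, ∑ a, φ (b - a) = 1 := sum_uniformDensity_sub_left K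
  have e1 : ∑ z, ∑ z', ∑ y, ∑ y', φ (z - z') * (φ (y - y') * ‖f y z‖ ^ 4)
      = ∑ y, ∑ z, ‖f y z‖ ^ 4 := by
    simp_rw [← Finset.mul_sum, ← Finset.sum_mul, hl, one_mul]
    exact Finset.sum_comm
  have e2 : ∑ z, ∑ z', ∑ y, ∑ y', φ (z - z') * (φ (y - y') * ‖f y z'‖ ^ 4)
      = ∑ y, ∑ z, ‖f y z‖ ^ 4 := by
    rw [Finset.sum_comm]
    simp_rw [← Finset.mul_sum, ← Finset.sum_mul, hl, hr, one_mul]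
    exact Finset.sum_comm
  have e3 : ∑ z, ∑ z', ∑ y, ∑ y', φ (z - z') * (φ (y - y') * ‖f y' z‖ ^ 4)
      = ∑ y, ∑ z, ‖f y z‖ ^ 4 := by
    simp_rw [← Finset.mul_sum]
    have : ∀ z, ∑ y, ∑ y', φ (y - y') * ‖f y' z‖ ^ 4 = ∑ y', ‖f y' z‖ ^ 4 := fun z => by
      rw [Finset.sum_comm]
      simp_rw [← Finset.sum_mul, hr, one_mul]
    simp_rw [this, ← Finset.sum_mul, hl, one_mul]
    exact Finset.sum_comm
  have e4 : ∑ z, ∑ z', ∑ y, ∑ y', φ (z - z') * (φ (y - y') * ‖f y' z'‖ ^ 4)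
      = ∑ y, ∑ z, ‖f y z‖ ^ 4 := by
    simp_rw [← Finset.mul_sum]
    have : ∀ z, ∑ y, ∑ y', φ (y - y') * ‖f y' z‖ ^ 4 = ∑ y', ‖f y' z‖ ^ 4 := fun z => by
      rw [Finset.sum_comm]
      simp_rw [← Finset.sum_mul, hr, one_mul]
    rw [Finset.sum_comm]
    simp_rw [this, ← Finset.sum_mul, hr, one_mul]
    exact Finset.sum_comm
  simp only [mul_div_assoc', ← Finset.sum_div, mul_add, Finset.sum_add_distrib, e1, e2, e3, e4]
  ring

/-! ### Triangular averages and the telescoping `ℓ²` estimate. -/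

/-- The averages of the product `f(y,z) g(x,z)` over `z ∈ x + y + K`. -/
def triAverage (K : AddSubgroup H) (f g : H → H → ℂ) (x y : H) : ℂ :=
  ∑ z, (uniformDensity K (z - x - y) : ℂ) * (f y z * g x z)

/-- Since `z - x - y ∈ K ≤ L`, the kernel of `L` at `z' - x - y` may be evaluated at `z - z'`. This
frees it from `x` and `y`, and only the kernel of `K` still couples them. -/
lemma sum_triAverage_mul_conj {K L : AddSubgroup H} (h : K ≤ L) (f g : H → H → ℂ) :
    ∑ x, ∑ y, triAverage K f g x y * conj (triAverage L f g x y)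
      = ∑ z, ∑ z', (uniformDensity L (z - z') : ℂ) * ∑ x, ∑ y,
        (uniformDensity K (z - x - y) : ℂ) *
          ((f y z * conj (f y z')) * (g x z * conj (g x z'))) := by
  simp only [triAverage, map_sum, Finset.sum_mul_sum]
  simp only [Finset.mul_sum]
  rw [sum_comm_pairs]
  refine Finset.sum_congr rfl fun z _ => Finset.sum_congr rfl fun z' _ =>
    Finset.sum_congr rfl fun x _ => Finset.sum_congr rfl fun y _ => ?_
  have h1 := uniformDensity_mul_of_le h (z - x - y) (z' - x - y)
  rw [show z' - x - y - (z - x - y) = -(z - z') by abel, uniformDensity_neg] at h1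
  have h2 : (uniformDensity K (z - x - y) : ℂ) * uniformDensity L (z' - x - y)
      = uniformDensity K (z - x - y) * uniformDensity L (z - z') := by exact_mod_cast h1
  simp only [map_mul, Complex.conj_ofReal]
  calc _ = (uniformDensity K (z - x - y) * uniformDensity L (z' - x - y) : ℂ)
        * (f y z * g x z * (conj (f y z') * conj (g x z'))) := by ring
    _ = _ := by rw [h2]; ring

/-- The squared `ℓ²` norm of a triangular subgroupAverage. -/
def triEnergy (K : AddSubgroup H) (f g : H → H → ℂ) : ℝ :=
  ∑ x, ∑ y, ‖triAverage K f g x y‖ ^ 2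

lemma triEnergy_nonneg (K : AddSubgroup H) (f g : H → H → ℂ) : 0 ≤ triEnergy K f g :=
  Finset.sum_nonneg fun _ _ => Finset.sum_nonneg fun _ _ => by positivity

lemma triEnergy_eq (K : AddSubgroup H) (f g : H → H → ℂ) :
    triEnergy K f g
      = (∑ x, ∑ y, triAverage K f g x y * conj (triAverage K f g x y)).re := by
  simp only [triEnergy, Complex.re_sum, Complex.mul_conj', ← Complex.ofReal_pow, Complex.ofReal_re]

/-- Jensen's inequality for the probability weights in `z`, then `2ab ≤ a² + b²`, then summation of
the kernel over the free variable. -/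
lemma triEnergy_le (K : AddSubgroup H) (f g : H → H → ℂ) :
    triEnergy K f g ≤ (∑ y, ∑ z, ‖f y z‖ ^ 4 + ∑ x, ∑ z, ‖g x z‖ ^ 4) / 2 := by
  have h1 : ∀ x y, ‖triAverage K f g x y‖ ^ 2
      ≤ ∑ z, uniformDensity K (z - x - y) * ((‖f y z‖ ^ 4 + ‖g x z‖ ^ 4) / 2) := fun x y => by
    have hs : ∑ z, uniformDensity K (z - x - y) = 1 := by
      simp_rw [sub_sub]; exact sum_uniformDensity_sub_right K _
    have h2 : ‖triAverage K f g x y‖ ≤ ∑ z, uniformDensity K (z - x - y) * (‖f y z‖ * ‖g x z‖) := by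
      refine (norm_sum_le _ _).trans (le_of_eq (Finset.sum_congr rfl fun z _ => ?_))
      rw [norm_mul, norm_mul, Complex.norm_real, Real.norm_of_nonneg (uniformDensity_nonneg _ _)]
    calc ‖triAverage K f g x y‖ ^ 2
        ≤ (∑ z, uniformDensity K (z - x - y) * (‖f y z‖ * ‖g x z‖)) ^ 2 := by gcongr
      _ ≤ ∑ z, uniformDensity K (z - x - y) * (‖f y z‖ * ‖g x z‖) ^ 2 :=
          (convexOn_pow 2).map_sum_le (fun z _ => uniformDensity_nonneg _ _) hs
            (fun z _ => Set.mem_Ici.2 (by positivity))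
      _ ≤ _ := by
          refine Finset.sum_le_sum fun z _ => mul_le_mul_of_nonneg_left ?_
            (uniformDensity_nonneg _ _)
          nlinarith [sq_nonneg (‖f y z‖ ^ 2 - ‖g x z‖ ^ 2)]
  refine (Finset.sum_le_sum fun x _ => Finset.sum_le_sum fun y _ => h1 x y).trans (le_of_eq ?_)
  simp only [mul_div_assoc', ← Finset.sum_div, mul_add, Finset.sum_add_distrib]
  congr 2
  · rw [Finset.sum_comm]
    refine Finset.sum_congr rfl fun y _ => ?_
    rw [Finset.sum_comm]
    refine Finset.sum_congr rfl fun z _ => ?_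
    rw [← Finset.sum_mul]
    have : ∑ x, uniformDensity K (z - x - y) = 1 := by
      simp_rw [sub_right_comm z _ y]; exact sum_uniformDensity_sub_left K _
    rw [this, one_mul]
  · refine Finset.sum_congr rfl fun x _ => ?_
    rw [Finset.sum_comm]
    refine Finset.sum_congr rfl fun z _ => ?_
    rw [← Finset.sum_mul, sum_uniformDensity_sub_left, one_mul]

/-- With `X = ⟨A_K, A_L⟩` and `Y = ⟨A_L, A_L⟩`, the left side is the difference of energies minus `2
Re (X - Y)`. In `X - Y` the kernel is the idempotent `ψ`, so `f` and `g` decouple into box forms, to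
which `boxForm_sub_le` applies. Each bracket on the right telescopes. -/
lemma sum_norm_triAverage_sub_sq_le {K L : AddSubgroup H} (h : K ≤ L) (f g : H → H → ℂ) :
    ∑ x, ∑ y, ‖triAverage K f g x y - triAverage L f g x y‖ ^ 2
      ≤ (triEnergy K f g - triEnergy L f g)
        + (boxForm f (uniformDensity K) (uniformDensity K)
          - boxForm f (uniformDensity L) (uniformDensity L))
        + (boxForm g (uniformDensity K) (uniformDensity K)
          - boxForm g (uniformDensity L) (uniformDensity L)) := by
  set ψ := uniformDensity K - uniformDensity L with hψ
  have hI : EvenIdempotent ψ := evenIdempotent_sub h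
  set X := ∑ x, ∑ y, triAverage K f g x y * conj (triAverage L f g x y) with hX
  set Y := ∑ x, ∑ y, triAverage L f g x y * conj (triAverage L f g x y) with hY
  have h1 : ∑ x, ∑ y, ‖triAverage K f g x y - triAverage L f g x y‖ ^ 2
      = triEnergy K f g - triEnergy L f g - 2 * (X - Y).re := by
    rw [Complex.sub_re, hY, ← triEnergy_eq, hX]
    simp only [triEnergy, Complex.re_sum, Finset.mul_sum, mul_sub, ← Finset.sum_sub_distrib]
    refine Finset.sum_congr rfl fun x _ => Finset.sum_congr rfl fun y _ => ?_
    have := Complex.normSq_sub (triAverage K f g x y) (triAverage L f g x y)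
    simp only [Complex.normSq_eq_norm_sq] at this
    rw [this]
    ring
  have h2 : X - Y = ∑ z, ∑ z', (uniformDensity L (z - z') : ℂ) * ∑ x, ∑ y,
        (ψ (z - x - y) : ℂ) * ((f y z * conj (f y z')) * (g x z * conj (g x z'))) := by
    rw [hX, hY, sum_triAverage_mul_conj h, sum_triAverage_mul_conj le_rfl]
    simp only [hψ, ← Finset.sum_sub_distrib, ← mul_sub, Pi.sub_apply, Complex.ofReal_sub, ← sub_mul]
  have h3 : ‖X - Y‖ ≤ (boxForm f (uniformDensity L) ψ + boxForm g (uniformDensity L) ψ) / 2 := by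
    rw [h2, hI.boxForm_right, hI.boxForm_right]
    simp only [← Finset.sum_add_distrib, Finset.sum_div]
    refine (norm_sum_le _ _).trans (Finset.sum_le_sum fun z _ => (norm_sum_le _ _).trans
      (Finset.sum_le_sum fun z' _ => ?_))
    rw [norm_mul, Complex.norm_real, Real.norm_of_nonneg (uniformDensity_nonneg _ _), ← mul_add,
      mul_div_assoc]
    exact mul_le_mul_of_nonneg_left (hI.norm_sum_le _ _ z) (uniformDensity_nonneg _ _)
  have h4 := (abs_le.1 ((Complex.abs_re_le_norm (X - Y)).trans h3)).1
  have h5 := boxForm_sub_le h f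
  have h6 := boxForm_sub_le h g
  rw [h1]
  linarith

lemma sum_succ_sub_castSucc {m : ℕ} (T : Fin (m + 1) → ℝ) :
    ∑ j : Fin m, (T j.succ - T j.castSucc) = T (Fin.last m) - T 0 := by
  have h1 := Fin.sum_univ_succ T
  have h2 := Fin.sum_univ_castSucc T
  rw [Finset.sum_sub_distrib]
  linarith

/-- After telescoping only the end terms remain. Those at the smallest subgroup contribute `1/2`
(energy) and `1` (box forms); those at the largest have a favourable sign. -/
theorem sum_triAverage_variation_sq_le {m : ℕ} (K : Fin (m + 1) → AddSubgroup H)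
    (hK : Antitone K) (f g : H → H → ℂ) :
    ∑ j : Fin m, ∑ x, ∑ y, ‖triAverage (K j.succ) f g x y - triAverage (K j.castSucc) f g x y‖ ^ 2
      ≤ 3 / 2 * (∑ y, ∑ z, ‖f y z‖ ^ 4 + ∑ x, ∑ z, ‖g x z‖ ^ 4) := by
  refine (Finset.sum_le_sum fun j _ => sum_norm_triAverage_sub_sq_le
    (hK (Fin.castSucc_lt_succ (i := j)).le) f g).trans ?_
  rw [Finset.sum_add_distrib, Finset.sum_add_distrib,
    sum_succ_sub_castSucc (fun j => triEnergy (K j) f g),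
    sum_succ_sub_castSucc (fun j => boxForm f (uniformDensity (K j)) (uniformDensity (K j))),
    sum_succ_sub_castSucc (fun j => boxForm g (uniformDensity (K j)) (uniformDensity (K j)))]
  have := triEnergy_le (K (Fin.last m)) f g
  have := triEnergy_nonneg (K 0) f g
  have := boxForm_uniformDensity_le f (K (Fin.last m))
  have := boxForm_uniformDensity_nonneg f (K 0)
  have := boxForm_uniformDensity_le g (K (Fin.last m))
  have := boxForm_uniformDensity_nonneg g (K 0)
  linarith

/-- The bilinear average over a subgroup `K`. -/
def subgroupAverage (K : AddSubgroup H) (F G : H × H → ℂ) (z : H × H) : ℂ :=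
  ∑ t, (uniformDensity K t : ℂ) * (F (z.1 + t, z.2) * G (z.1, z.2 + t))

/-- The substitution `z = x + y + t` makes the factor from `F` depend on `(y, z)` only and the
factor from `G` on `(x, z)` only. -/
lemma average_eq_triAverage (K : AddSubgroup H) (F G : H × H → ℂ) (x y : H) :
    subgroupAverage K F G (x, y)
      = triAverage K (fun y z => F (z - y, y)) (fun x z => G (x, z - x)) x y := by
  rw [subgroupAverage, triAverage, ← Equiv.sum_comp (Equiv.subRight (x + y))]
  refine Finset.sum_congr rfl fun z _ => ?_
  simp only [Equiv.subRight_apply, sub_sub]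
  rw [show x + (z - (x + y)) = z - y by abel, show y + (z - (x + y)) = z - x by abel]

theorem sum_average_variation_sq_le {m : ℕ} (K : Fin (m + 1) → AddSubgroup H)
    (hK : Antitone K) (F G : H × H → ℂ) :
    ∑ j : Fin m, ∑ z, ‖subgroupAverage (K j.succ) F G z - subgroupAverage (K j.castSucc) F G z‖ ^ 2
      ≤ 3 / 2 * (∑ z, ‖F z‖ ^ 4 + ∑ z, ‖G z‖ ^ 4) := by
  have h := sum_triAverage_variation_sq_le K hK (fun y z => F (z - y, y)) (fun x z => G (x, z - x))
  have h1 : ∑ y, ∑ z, ‖F (z - y, y)‖ ^ 4 = ∑ z, ‖F z‖ ^ 4 := by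
    rw [Fintype.sum_prod_type_right]
    exact Finset.sum_congr rfl fun y _ =>
      Equiv.sum_comp (Equiv.subRight y) (fun z => ‖F (z, y)‖ ^ 4)
  have h2 : ∑ x, ∑ z, ‖G (x, z - x)‖ ^ 4 = ∑ z, ‖G z‖ ^ 4 := by
    rw [Fintype.sum_prod_type]
    exact Finset.sum_congr rfl fun x _ =>
      Equiv.sum_comp (Equiv.subRight x) (fun z => ‖G (x, z)‖ ^ 4)
  simp only [h1, h2] at h
  refine le_trans (le_of_eq (Finset.sum_congr rfl fun j _ => ?_)) h
  rw [Fintype.sum_prod_type]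
  simp only [average_eq_triAverage]

lemma norm_average_le (K : AddSubgroup H) {F G : H × H → ℂ} (hF : ∀ z, ‖F z‖ ≤ 1)
    (hG : ∀ z, ‖G z‖ ≤ 1) (z : H × H) : ‖subgroupAverage K F G z‖ ≤ 1 := by
  refine (norm_sum_le _ _).trans ?_
  rw [← sum_uniformDensity K]
  refine Finset.sum_le_sum fun t _ => ?_
  rw [norm_mul, norm_mul, Complex.norm_real, Real.norm_of_nonneg (uniformDensity_nonneg _ _)]
  exact mul_le_of_le_one_right (uniformDensity_nonneg _ _)
    (mul_le_one₀ (hF _) (norm_nonneg _) (hG _))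

end FiniteGroupAverages

/-! ### Complex interpolation by the three lines theorem. -/

namespace ComplexInterpolation

open Finset ComplexConjugate Complex

/-- The number with the phase of `w` and modulus `‖w‖ ^ z`; zero if `w = 0`. -/
def phasePow (w z : ℂ) : ℂ := w / ‖w‖ * exp (z * Real.log ‖w‖)

lemma differentiable_phasePow (w : ℂ) : Differentiable ℂ (phasePow w) := by
  unfold phasePow
  fun_prop

lemma phasePow_zero_left (z : ℂ) : phasePow 0 z = 0 := by simp [phasePow]

lemma norm_phasePow {w : ℂ} (hw : w ≠ 0) (z : ℂ) : ‖phasePow w z‖ = ‖w‖ ^ z.re := by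
  have h : 0 < ‖w‖ := norm_pos_iff.2 hw
  rw [phasePow, norm_mul, norm_div, norm_real, norm_norm, div_self h.ne', one_mul, norm_exp,
    Real.rpow_def_of_pos h, re_mul_ofReal, mul_comm]

lemma norm_phasePow_le (w z : ℂ) : ‖phasePow w z‖ ≤ ‖w‖ ^ z.re := by
  by_cases hw : w = 0
  · subst hw
    rw [phasePow_zero_left, norm_zero]
    positivity
  · exact (norm_phasePow hw z).le

lemma phasePow_one (w : ℂ) : phasePow w 1 = w := by
  by_cases hw : w = 0
  · rw [hw, phasePow_zero_left]
  · have h : 0 < ‖w‖ := norm_pos_iff.2 hw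
    have h' : (‖w‖ : ℂ) ≠ 0 := by exact_mod_cast h.ne'
    rw [phasePow, one_mul, ← ofReal_exp, Real.exp_log h, div_mul_cancel₀ _ h']

lemma mul_phasePow_conj (w : ℂ) {q : ℝ} (hq : q ≠ 0) :
    w * phasePow (conj w) ((q - 1 : ℝ) : ℂ) = ((‖w‖ ^ q : ℝ) : ℂ) := by
  by_cases hw : w = 0
  · rw [hw, map_zero, phasePow_zero_left, norm_zero, Real.zero_rpow hq]
    simp
  · have h : 0 < ‖w‖ := norm_pos_iff.2 hw
    have h' : (‖w‖ : ℂ) ≠ 0 := by exact_mod_cast h.ne'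
    rw [phasePow, RCLike.norm_conj, ← mul_assoc, mul_div_assoc', mul_conj', ← ofReal_mul,
      ← ofReal_exp, mul_comm (q - 1), ← Real.rpow_def_of_pos h, Real.rpow_sub_one h.ne']
    push_cast
    field_simp

/-- Interpolation between an `ℓ⁴ × ℓ⁴ → ℓ²` bound and the trivial `ℓ^∞` bound for finite
families of functionals depending analytically on two functions. -/
theorem sum_norm_rpow_le_of_interpolation {I κ : Type*} [Fintype I] [Fintype κ]
    (B : κ → (I → ℂ) → (I → ℂ) → ℂ)
    (hdiff : ∀ F G : ℂ → I → ℂ, (∀ i, Differentiable ℂ fun z => F z i) →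
      (∀ i, Differentiable ℂ fun z => G z i) → ∀ k, Differentiable ℂ fun z => B k (F z) (G z))
    (hinf : ∀ F G : I → ℂ, (∀ i, ‖F i‖ ≤ 1) → (∀ i, ‖G i‖ ≤ 1) → ∀ k, ‖B k F G‖ ≤ 2)
    {C : ℝ} (h2 : ∀ F G : I → ℂ, ∑ i, ‖F i‖ ^ 4 ≤ 1 → ∑ i, ‖G i‖ ^ 4 ≤ 1 →
      ∑ k, ‖B k F G‖ ^ 2 ≤ C)
    {p : ℝ} (hp : 2 ≤ p) {F G : I → ℂ} (hF : ∑ i, ‖F i‖ ^ (2 * p) ≤ 1)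
    (hG : ∑ i, ‖G i‖ ^ (2 * p) ≤ 1) :
    ∑ k, ‖B k F G‖ ^ p ≤ 2 ^ (p - 2) * C := by
  have hp0 : 0 < p := by linarith
  have hC : 0 ≤ C := (Finset.sum_nonneg fun k _ => by positivity).trans
    (h2 0 0 (by simp) (by simp))
  have hle1 : ∀ F : I → ℂ, ∑ i, ‖F i‖ ^ (2 * p) ≤ 1 → ∀ i, ‖F i‖ ≤ 1 := fun F hF i => by
    by_contra! h
    have h1 : ‖F i‖ ^ (2 * p) ≤ 1 := (Finset.single_le_sum (f := fun i => ‖F i‖ ^ (2 * p))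
      (fun i _ => by positivity) (Finset.mem_univ i)).trans hF
    exact absurd h1 (not_le.2 (Real.one_lt_rpow h (by linarith)))
  set D : κ → ℂ := fun k => B k F G with hD
  have hD2 : ∀ k, ‖D k‖ ≤ 2 := hinf F G (hle1 F hF) (hle1 G hG)
  set S : ℝ := ∑ k, ‖D k‖ ^ p with hS
  have hS0 : 0 ≤ S := Finset.sum_nonneg fun k _ => by positivity
  change S ≤ _
  -- A power of `S` is cancelled at the end, so `S = 0` is treated separately.
  rcases hS0.eq_or_lt with hS0' | hSpos
  · rw [← hS0']; positivity
  -- Analytic family through `F` at `z = 2 / p`: its moduli are at most `1` on `Re z = 0` and at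
  -- most `‖F i‖ ^ (p / 2)` on `Re z = 1`, where the `ℓ⁴` hypothesis applies.
  let E : (I → ℂ) → ℂ → I → ℂ := fun F z i => phasePow (F i) ((p / 2 : ℝ) * z)
  have hEdiff : ∀ F i, Differentiable ℂ fun z => E F z i := fun F i =>
    (differentiable_phasePow (F i)).comp (by fun_prop)
  have hEle : ∀ F i z, ‖E F z i‖ ≤ ‖F i‖ ^ (p / 2 * z.re) := fun F i z => by
    refine (norm_phasePow_le _ _).trans_eq ?_
    rw [re_ofReal_mul]
  have hEle1 : ∀ F, (∑ i, ‖F i‖ ^ (2 * p) ≤ 1) → ∀ z : ℂ, 0 ≤ z.re → ∀ i, ‖E F z i‖ ≤ 1 :=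
    fun F hF z hz i => (hEle F i z).trans
      (Real.rpow_le_one (norm_nonneg _) (hle1 F hF i) (by positivity))
  have hE4 : ∀ F, (∑ i, ‖F i‖ ^ (2 * p) ≤ 1) → ∀ z : ℂ, z.re = 1 → ∑ i, ‖E F z i‖ ^ 4 ≤ 1 :=
    fun F hF z hz => by
      refine le_trans (Finset.sum_le_sum fun i _ => ?_) hF
      refine (pow_le_pow_left₀ (norm_nonneg _) (hEle F i z) 4).trans_eq ?_
      rw [hz, mul_one, ← Real.rpow_mul_natCast (norm_nonneg _)]
      congr 1
      push_cast
      ring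
  have hEp : ∀ F, E F ((2 / p : ℝ) : ℂ) = F := fun F => by
    funext i
    simp only [E]
    rw [← ofReal_mul, show p / 2 * (2 / p) = 1 by field_simp, ofReal_one, phasePow_one]
  -- Dual family: at `z = 2 / p` the exponent is `p - 1`, so that pairing with `D` yields `∑ ‖D k‖ ^
  -- p = S`.
  let W : ℂ → κ → ℂ := fun z k => phasePow (conj (D k)) ((p : ℝ) - (p / 2 : ℝ) * z)
  have hWle : ∀ z k, ‖W z k‖ ≤ ‖D k‖ ^ (p - p / 2 * z.re) := fun z k => by
    refine (norm_phasePow_le _ _).trans_eq ?_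
    rw [sub_re, re_ofReal_mul, ofReal_re, RCLike.norm_conj]
  have hWdiff : ∀ k, Differentiable ℂ fun z => W z k := fun k =>
    (differentiable_phasePow _).comp (by fun_prop)
  let Φ : ℂ → ℂ := fun z => ∑ k, B k (E F z) (E G z) * W z k
  have hΦdiff : Differentiable ℂ Φ := Differentiable.fun_sum fun k _ =>
    (hdiff (E F) (E G) (hEdiff F) (hEdiff G) k).mul (hWdiff k)
  have hBle : ∀ z : ℂ, 0 ≤ z.re → ∀ k, ‖B k (E F z) (E G z)‖ ≤ 2 := fun z hz =>
    hinf _ _ (hEle1 F hF z hz) (hEle1 G hG z hz)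
  have hΦle : ∀ z, ‖Φ z‖ ≤ ∑ k, ‖B k (E F z) (E G z)‖ * ‖D k‖ ^ (p - p / 2 * z.re) := fun z =>
    (norm_sum_le _ _).trans (Finset.sum_le_sum fun k _ => by
      rw [norm_mul]
      exact mul_le_mul_of_nonneg_left (hWle z k) (norm_nonneg _))
  have hbdd : BddAbove ((norm ∘ Φ) '' HadamardThreeLines.verticalClosedStrip 0 1) := by
    refine ⟨∑ _k : κ, 2 * (2 : ℝ) ^ p, ?_⟩
    rintro _ ⟨z, hz, rfl⟩
    have hz' : 0 ≤ z.re ∧ z.re ≤ 1 := hz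
    refine (hΦle z).trans (Finset.sum_le_sum fun k _ => ?_)
    refine mul_le_mul (hBle z hz'.1 k) ?_ (by positivity) (by norm_num)
    have h3 : 0 ≤ p - p / 2 * z.re := by nlinarith [hz'.1, hz'.2]
    refine (Real.rpow_le_rpow (norm_nonneg _) (hD2 k) h3).trans ?_
    exact Real.rpow_le_rpow_of_exponent_le one_le_two (by nlinarith [hz'.1, hz'.2])
  have ha : ∀ z ∈ re ⁻¹' {(0 : ℝ)}, ‖Φ z‖ ≤ 2 * S := fun z hz => by
    have hz' : z.re = 0 := hz
    refine (hΦle z).trans ?_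
    rw [hS, Finset.mul_sum]
    refine Finset.sum_le_sum fun k _ => ?_
    rw [hz', mul_zero, sub_zero]
    exact mul_le_mul_of_nonneg_right (hBle z hz'.ge k) (by positivity)
  -- On `Re z = 1`, Cauchy–Schwarz applies, with `‖W z k‖ ^ 2 ≤ ‖D k‖ ^ p`.
  have hb : ∀ z ∈ re ⁻¹' {(1 : ℝ)}, ‖Φ z‖ ≤ √(C * S) := fun z hz => by
    have hz' : z.re = 1 := hz
    refine (hΦle z).trans (Real.le_sqrt_of_sq_le ?_)
    refine (Finset.sum_mul_sq_le_sq_mul_sq _ _ _).trans ?_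
    refine mul_le_mul (h2 _ _ (hE4 F hF z hz') (hE4 G hG z hz')) (le_of_eq ?_)
      (Finset.sum_nonneg fun k _ => by positivity) hC
    refine Finset.sum_congr rfl fun k _ => ?_
    rw [hz', ← Real.rpow_mul_natCast (norm_nonneg _)]
    congr 1
    push_cast
    ring
  have hθ : ((2 / p : ℝ) : ℂ) ∈ HadamardThreeLines.verticalClosedStrip 0 1 := by
    change 0 ≤ (((2 / p : ℝ) : ℂ)).re ∧ (((2 / p : ℝ) : ℂ)).re ≤ 1
    rw [ofReal_re]
    exact ⟨by positivity, by rw [div_le_one hp0]; exact hp⟩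
  have hmain := HadamardThreeLines.norm_le_interp_of_mem_verticalClosedStrip' zero_lt_one hθ
    hΦdiff.diffContOnCl hbdd ha hb
  have hΦS : Φ ((2 / p : ℝ) : ℂ) = (S : ℂ) := by
    simp only [Φ, hEp, W, hS, ofReal_sum]
    refine Finset.sum_congr rfl fun k _ => ?_
    rw [← mul_phasePow_conj _ hp0.ne', ← ofReal_mul, ← ofReal_sub,
      show p / 2 * (2 / p) = 1 by field_simp]
  rw [hΦS, norm_real, Real.norm_of_nonneg hS0, ofReal_re, sub_zero, sub_zero, div_one] at hmain
  -- Three lines gives `S ≤ (2S)^(1 - 2/p) * √(CS)^(2/p)`. Its `p`-th power is `S^p ≤ 2^(p-2) *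
  -- S^(p-2) * C * S`, from which `S^(p-1)` cancels.
  have hpow := Real.rpow_le_rpow hS0 hmain hp0.le
  rw [Real.mul_rpow (by positivity) (by positivity), ← Real.rpow_mul (by positivity),
    ← Real.rpow_mul (by positivity), show (1 - 2 / p) * p = p - 2 by field_simp,
    show 2 / p * p = 2 by field_simp, Real.rpow_two, Real.sq_sqrt (by positivity),
    Real.mul_rpow (by norm_num) hS0, show p = (p - 2) + 1 + 1 by ring, Real.rpow_add_one hSpos.ne',
    Real.rpow_add_one hSpos.ne', show p - 2 + 1 + 1 - 2 = p - 2 by ring] at hpow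
  have hT : 0 < S ^ (p - 2) * S := by positivity
  refine le_of_mul_le_mul_left ?_ hT
  linarith

end ComplexInterpolation

/-! ### The `ℓ^p` variation bound on finite groups. -/

namespace FiniteGroupAverages

open Finset

variable {H : Type*} [AddCommGroup H] [Fintype H]

lemma average_smul_smul (K : AddSubgroup H) (a b : ℂ) (F G : H × H → ℂ) (z : H × H) :
    subgroupAverage K (a • F) (b • G) z = a * b * subgroupAverage K F G z := by
  simp only [subgroupAverage, Finset.mul_sum, Pi.smul_apply, smul_eq_mul]
  exact Finset.sum_congr rfl fun t _ => by ring

lemma sum_average_variation_rpow_le_of_le_one {m : ℕ} (K : Fin (m + 1) → AddSubgroup H)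
    (hK : Antitone K) {p : ℝ} (hp : 2 ≤ p) {F G : H × H → ℂ}
    (hF : ∑ z, ‖F z‖ ^ (2 * p) ≤ 1) (hG : ∑ z, ‖G z‖ ^ (2 * p) ≤ 1) :
    ∑ j : Fin m, ∑ z, ‖subgroupAverage (K j.succ) F G z - subgroupAverage (K j.castSucc) F G z‖ ^ p
      ≤ 2 ^ (p - 2) * 3 := by
  have h := ComplexInterpolation.sum_norm_rpow_le_of_interpolation (I := H × H)
    (κ := Fin m × (H × H))
    (fun k F G => subgroupAverage (K k.1.succ) F G k.2 - subgroupAverage (K k.1.castSucc) F G k.2)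
    (fun F G hF hG k => by
      unfold subgroupAverage
      exact (Differentiable.fun_sum fun t _ => ((hF _).mul (hG _)).const_mul _).sub
        (Differentiable.fun_sum fun t _ => ((hF _).mul (hG _)).const_mul _))
    (fun F G hF hG k => (norm_sub_le _ _).trans (by
      linarith [norm_average_le (K k.1.succ) hF hG k.2, norm_average_le (K k.1.castSucc) hF hG k.2]))
    -- `3 = 3 / 2 * (1 + 1)` under the `ℓ⁴` normalization.
    (C := 3)
    (fun F G hF hG => by
      rw [Fintype.sum_prod_type]
      refine (sum_average_variation_sq_le K hK F G).trans ?_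
      linarith) hp hF hG
  rwa [Fintype.sum_prod_type] at h

theorem sum_average_variation_rpow_le {m : ℕ} (K : Fin (m + 1) → AddSubgroup H)
    (hK : Antitone K) {p : ℝ} (hp : 2 ≤ p) (F G : H × H → ℂ) :
    ∑ j : Fin m, ∑ z, ‖subgroupAverage (K j.succ) F G z - subgroupAverage (K j.castSucc) F G z‖ ^ p
      ≤ 2 ^ (p - 2) * 3 * (∑ z, ‖F z‖ ^ (2 * p)) ^ (1 / 2 : ℝ)
        * (∑ z, ‖G z‖ ^ (2 * p)) ^ (1 / 2 : ℝ) := by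
  have hp0 : 0 < p := by linarith
  -- Normalization with `a` the `ℓ^(2p)` norm of `F`; both sides are homogeneous of degree `p` in
  -- each function.
  have key : ∀ F : H × H → ℂ, ∃ (a : ℝ) (F' : H × H → ℂ), 0 ≤ a ∧ F = (a : ℂ) • F' ∧
      ∑ z, ‖F' z‖ ^ (2 * p) ≤ 1 ∧ a ^ p = (∑ z, ‖F z‖ ^ (2 * p)) ^ (1 / 2 : ℝ) := fun F => by
    have hS : 0 ≤ ∑ z, ‖F z‖ ^ (2 * p) := Finset.sum_nonneg fun z _ => by positivity
    rcases hS.eq_or_lt with h0 | hpos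
    · refine ⟨0, 0, le_rfl, ?_, ?_, ?_⟩
      · funext z
        have := (Finset.sum_eq_zero_iff_of_nonneg (fun z _ => by positivity)).1 h0.symm z
          (Finset.mem_univ z)
        rw [Real.rpow_eq_zero (norm_nonneg _) (by positivity), norm_eq_zero] at this
        simp [this]
      · simp [Real.zero_rpow (show 2 * p ≠ 0 by positivity)]
      · rw [← h0, Real.zero_rpow hp0.ne', Real.zero_rpow (by norm_num)]
    · set S := ∑ z, ‖F z‖ ^ (2 * p) with hSdef
      have ha : 0 < S ^ (1 / (2 * p)) := Real.rpow_pos_of_pos hpos _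
      have ha' : ((S ^ (1 / (2 * p)) : ℝ) : ℂ) ≠ 0 := by exact_mod_cast ha.ne'
      refine ⟨S ^ (1 / (2 * p)), (((S ^ (1 / (2 * p)) : ℝ) : ℂ))⁻¹ • F, ha.le, ?_, ?_, ?_⟩
      · rw [smul_smul, mul_inv_cancel₀ ha', one_smul]
      · have : ∀ z, ‖((((S ^ (1 / (2 * p)) : ℝ) : ℂ))⁻¹ • F) z‖ ^ (2 * p)
            = S⁻¹ * ‖F z‖ ^ (2 * p) := fun z => by
          rw [Pi.smul_apply, smul_eq_mul, norm_mul, norm_inv, Complex.norm_real,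
            Real.norm_of_nonneg ha.le, Real.mul_rpow (by positivity) (norm_nonneg _),
            Real.inv_rpow ha.le, ← Real.rpow_mul hpos.le,
            show 1 / (2 * p) * (2 * p) = 1 by field_simp, Real.rpow_one]
        simp_rw [this]
        rw [← Finset.mul_sum, ← hSdef, inv_mul_cancel₀ hpos.ne']
      · rw [← Real.rpow_mul hpos.le]
        congr 1
        field_simp
  obtain ⟨a, F', ha, hFa, hF', hap⟩ := key F
  obtain ⟨b, G', hb, hGb, hG', hbp⟩ := key G
  have h1 : ∀ j : Fin m, ∀ z, ‖subgroupAverage (K j.succ) F G z - subgroupAverage (K j.castSucc) F G z‖ ^ p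
      = a ^ p * b ^ p * ‖subgroupAverage (K j.succ) F' G' z - subgroupAverage (K j.castSucc) F' G' z‖ ^ p :=
    fun j z => by
      rw [hFa, hGb, average_smul_smul, average_smul_smul, ← mul_sub, norm_mul, norm_mul,
        Complex.norm_real, Complex.norm_real, Real.norm_of_nonneg ha, Real.norm_of_nonneg hb,
        Real.mul_rpow (by positivity) (norm_nonneg _), Real.mul_rpow ha hb]
  simp_rw [h1, ← Finset.mul_sum]
  rw [← hap, ← hbp]
  have h2 := mul_le_mul_of_nonneg_left (sum_average_variation_rpow_le_of_le_one K hK hp hF' hG')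
    (show 0 ≤ a ^ p * b ^ p by positivity)
  linarith

end FiniteGroupAverages

lemma measurableEmbedding_coe_nnreal : MeasurableEmbedding ((↑) : ℝ≥0 → ℝ) :=
  MeasurableEmbedding.subtype_coe measurableSet_Ici

lemma halfLineVolume_Ico (a b : ℝ≥0) : halfLineVolume (Set.Ico a b) = ((b - a : ℝ≥0) : ℝ≥0∞) := by
  rw [halfLineVolume, measurableEmbedding_coe_nnreal.comap_apply]
  have : ((↑) : ℝ≥0 → ℝ) '' Set.Ico a b = Set.Ico (a : ℝ) b := by
    ext x
    constructor
    · rintro ⟨y, ⟨h1, h2⟩, rfl⟩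
      exact ⟨h1, h2⟩
    · rintro ⟨h1, h2⟩
      exact ⟨⟨x, a.2.trans h1⟩, ⟨h1, h2⟩, rfl⟩
  rw [this, Real.volume_Ico, ← ENNReal.ofReal_coe_nnreal, ENNReal.ofReal, ENNReal.ofReal,
    Real.toNNReal_coe, NNReal.sub_def]

instance nullSingletonClass_halfLineVolume : NullSingletonClass halfLineVolume := by
  refine ⟨fun x => ?_⟩
  rw [halfLineVolume, measurableEmbedding_coe_nnreal.comap_apply, Set.image_singleton]
  exact Real.volume_singleton

/-! ### Blocks of digits, cells, and digitwise addition up to null sets. -/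

namespace CantorGroup

variable {A : Type*} [AddCommGroup A] [Finite A] (e : DigitLabelling A)

/-- The digits of `t` at the positions `-n, …, n - 1`. -/
def digits (n : ℕ) (t : ℝ≥0) : Fin (2 * n) → A := fun i => digit e t ((i : ℤ) - n)

/-- The integer whose base `d` expansion is a given block of digits. -/
def cellIndex (n : ℕ) : (Fin (2 * n) → A) ≃ Fin (Nat.card A ^ (2 * n)) :=
  (Equiv.arrowCongr (Equiv.refl _) e.toEquiv).trans finFunctionFinEquiv

lemma cellIndex_apply (n : ℕ) (h : Fin (2 * n) → A) :
    (cellIndex e n h : ℕ) = ∑ i, (e.toEquiv (h i) : ℕ) * Nat.card A ^ (i : ℕ) := rfl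

lemma card_pos_nnreal : (0 : ℝ≥0) < Nat.card A := by exact_mod_cast Nat.card_pos

lemma floor_lt_of_lt {n : ℕ} {t : ℝ≥0} (ht : t < (Nat.card A : ℝ≥0) ^ n) :
    ⌊(Nat.card A : ℝ≥0) ^ n * t⌋₊ < Nat.card A ^ (2 * n) := by
  rw [Nat.floor_lt (by positivity), two_mul, pow_add]
  push_cast
  exact mul_lt_mul_of_pos_left ht (pow_pos card_pos_nnreal n)

omit [AddCommGroup A] [Finite A] in
lemma lt_of_floor_lt {n : ℕ} {t : ℝ≥0}
    (ht : ⌊(Nat.card A : ℝ≥0) ^ n * t⌋₊ < Nat.card A ^ (2 * n)) : t < (Nat.card A : ℝ≥0) ^ n := by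
  rw [Nat.floor_lt (by positivity), two_mul, pow_add] at ht
  push_cast at ht
  exact lt_of_mul_lt_mul_left ht (by positivity)

/-- The digit of `t` at position `i - n` is the `i`-th base `d` digit of `⌊dⁿ t⌋`, because `⌊d^(n-i)
t⌋ = ⌊dⁿ t⌋ / dⁱ`. -/
lemma digits_eq_of_floor_eq {n : ℕ} {t : ℝ≥0} {h : Fin (2 * n) → A}
    (ht : ⌊(Nat.card A : ℝ≥0) ^ n * t⌋₊ = cellIndex e n h) : digits e n t = h := by
  have hd : (Nat.card A : ℝ≥0) ≠ 0 := card_pos_nnreal.ne'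
  rw [← (cellIndex e n).symm_apply_apply h]
  funext i
  change _ = e.toEquiv.symm (finFunctionFinEquiv.symm (cellIndex e n h) i)
  rw [digits, digit]
  congr 1
  ext
  rw [finFunctionFinEquiv_symm_apply_val, ← ht, ← Nat.floor_div_natCast]
  push_cast
  rw [neg_sub, zpow_sub₀ hd, zpow_natCast, zpow_natCast, div_mul_eq_mul_div]

lemma cellIndex_digits {n : ℕ} {t : ℝ≥0} (ht : t < (Nat.card A : ℝ≥0) ^ n) :
    (cellIndex e n (digits e n t) : ℕ) = ⌊(Nat.card A : ℝ≥0) ^ n * t⌋₊ := by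
  have h : ⌊(Nat.card A : ℝ≥0) ^ n * t⌋₊
      = cellIndex e n ((cellIndex e n).symm ⟨_, floor_lt_of_lt ht⟩) := by
    rw [Equiv.apply_symm_apply]
  rw [digits_eq_of_floor_eq e h, ← h]

/-- The set of the points of `[0, dⁿ)` with prescribed digits at the positions `-n, …, n - 1`. -/
def cell (n : ℕ) (h : Fin (2 * n) → A) : Set ℝ≥0 :=
  {t | t < (Nat.card A : ℝ≥0) ^ n ∧ digits e n t = h}

lemma cell_eq (n : ℕ) (h : Fin (2 * n) → A) :
    cell e n h = {t | ⌊(Nat.card A : ℝ≥0) ^ n * t⌋₊ = cellIndex e n h} := by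
  ext t
  constructor
  · rintro ⟨ht, rfl⟩
    exact (cellIndex_digits e ht).symm
  · intro ht
    exact ⟨lt_of_floor_lt (ht.trans_lt (cellIndex e n h).2), digits_eq_of_floor_eq e ht⟩

lemma cell_eq_Ico (n : ℕ) (h : Fin (2 * n) → A) :
    cell e n h = Set.Ico ((cellIndex e n h : ℕ) / (Nat.card A : ℝ≥0) ^ n)
      (((cellIndex e n h : ℕ) + 1) / (Nat.card A : ℝ≥0) ^ n) := by
  have hd : (0 : ℝ≥0) < (Nat.card A : ℝ≥0) ^ n := pow_pos card_pos_nnreal n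
  rw [cell_eq]
  ext t
  rw [Set.mem_ofPred_eq, Nat.floor_eq_iff (by positivity), Set.mem_Ico, div_le_iff₀' hd,
    lt_div_iff₀' hd]

lemma measurableSet_cell (n : ℕ) (h : Fin (2 * n) → A) : MeasurableSet (cell e n h) := by
  rw [cell_eq_Ico]
  exact measurableSet_Ico

lemma halfLineVolume_cell (n : ℕ) (h : Fin (2 * n) → A) :
    halfLineVolume (cell e n h) = ((((Nat.card A : ℝ≥0) ^ n)⁻¹ : ℝ≥0) : ℝ≥0∞) := by
  rw [cell_eq_Ico, halfLineVolume_Ico, ← NNReal.sub_div, add_tsub_cancel_left, one_div]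

lemma indicator_comp_digits_eq_sum {E : Type*} [AddCommMonoid E] (n : ℕ)
    [Fintype (Fin (2 * n) → A)] (φ : (Fin (2 * n) → A) → E) (t : ℝ≥0) :
    (Set.Iio ((Nat.card A : ℝ≥0) ^ n)).indicator (fun t => φ (digits e n t)) t
      = ∑ h, (cell e n h).indicator (fun _ => φ h) t := by
  classical
  by_cases ht : t < (Nat.card A : ℝ≥0) ^ n
  · rw [Set.indicator_of_mem (show t ∈ Set.Iio _ from ht),
      Finset.sum_eq_single (digits e n t)]
    · rw [Set.indicator_of_mem (show t ∈ cell e n _ from ⟨ht, rfl⟩)]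
    · intro h _ hne
      exact Set.indicator_of_notMem (fun hm : t ∈ cell e n h => hne hm.2.symm) _
    · simp
  · rw [Set.indicator_of_notMem (show t ∉ Set.Iio _ from ht), eq_comm]
    exact Finset.sum_eq_zero fun h _ =>
      Set.indicator_of_notMem (fun hm : t ∈ cell e n h => ht hm.1) _

lemma integral_comp_digits (n : ℕ) [Fintype (Fin (2 * n) → A)] (φ : (Fin (2 * n) → A) → ℂ) :
    ∫ t in Set.Iio ((Nat.card A : ℝ≥0) ^ n), φ (digits e n t) ∂halfLineVolume
      = ((Nat.card A : ℂ) ^ n)⁻¹ * ∑ h, φ h := by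
  rw [← integral_indicator measurableSet_Iio]
  simp_rw [indicator_comp_digits_eq_sum]
  rw [integral_finsetSum _ fun h _ => ?_, Finset.mul_sum]
  · refine Finset.sum_congr rfl fun h _ => ?_
    rw [integral_indicator_const _ (measurableSet_cell e n h), Measure.real, halfLineVolume_cell,
      ENNReal.coe_toReal]
    push_cast
    rw [Complex.real_smul]
    push_cast
    rfl
  · refine (integrable_indicator_iff (measurableSet_cell e n h)).2 (integrableOn_const ?_)
    rw [halfLineVolume_cell]
    exact ENNReal.coe_ne_top

/-- The blocks of digits that vanish at the positions `≥ -k`. -/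
def blockSubgroup (A : Type*) [AddCommGroup A] (n : ℕ) (k : ℤ) :
    AddSubgroup (Fin (2 * n) → A) where
  carrier := {h | ∀ i : Fin (2 * n), -k ≤ (i : ℤ) - n → h i = 0}
  zero_mem' := fun _ _ => rfl
  add_mem' := fun ha hb i hi => by rw [Pi.add_apply, ha i hi, hb i hi, add_zero]
  neg_mem' := fun ha i hi => by rw [Pi.neg_apply, ha i hi, neg_zero]

omit [Finite A] in
lemma antitone_blockSubgroup (n : ℕ) : Antitone (blockSubgroup A n) :=
  fun _ _ hkl _ ha i hi => ha i ((neg_le_neg hkl).trans hi)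

lemma digit_eq_zero_of_lt {t : ℝ≥0} {k : ℤ} (ht : t < (Nat.card A : ℝ≥0) ^ k) :
    digit e t k = 0 := by
  refine digit_eq_zero_of_mod_eq_zero e t k ?_
  have h3 : (Nat.card A : ℝ≥0) ^ (-k) * t < 1 := by
    rw [zpow_neg, ← div_eq_inv_mul]
    exact (div_lt_one (zpow_pos card_pos_nnreal k)).mpr ht
  rw [Nat.floor_eq_zero.mpr h3, Nat.zero_mod]

lemma digit_ne_zero {t : ℝ≥0} {k : ℤ} (h1 : (Nat.card A : ℝ≥0) ^ k ≤ t)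
    (h2 : t < (Nat.card A : ℝ≥0) ^ (k + 1)) : digit e t k ≠ 0 := by
  intro h
  have hk : (0 : ℝ≥0) < (Nat.card A : ℝ≥0) ^ k := zpow_pos card_pos_nnreal k
  rw [digit, Equiv.symm_apply_eq] at h
  have h3 := congrArg Fin.val h
  rw [e.map_zero] at h3
  have h4 : 1 ≤ ⌊(Nat.card A : ℝ≥0) ^ (-k) * t⌋₊ := by
    rw [Nat.one_le_floor_iff, zpow_neg, ← div_eq_inv_mul]
    exact (one_le_div hk).2 h1
  have h5 : ⌊(Nat.card A : ℝ≥0) ^ (-k) * t⌋₊ < Nat.card A := by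
    rw [Nat.floor_lt (by positivity), zpow_neg, ← div_eq_inv_mul, div_lt_iff₀ hk, mul_comm,
      ← zpow_add_one₀ card_pos_nnreal.ne']
    exact h2
  simp only [Nat.mod_eq_of_lt h5] at h3
  omega

/-- If `t ≥ d⁻ᵏ`, its leading digit is nonzero and sits at a position `j` with `-k ≤ j < n`; by `k ≤
n` this position is inside the block. -/
lemma digits_mem_blockSubgroup_iff (hd : 1 < Nat.card A) {n : ℕ} {k : ℤ} {t : ℝ≥0}
    (hk : k ≤ n) (ht : t < (Nat.card A : ℝ≥0) ^ n) :
    digits e n t ∈ blockSubgroup A n k ↔ t < (Nat.card A : ℝ≥0) ^ (-k) := by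
  have hd1 : (1 : ℝ≥0) < Nat.card A := by exact_mod_cast hd
  constructor
  · intro h
    by_contra! hle
    have ht0 : t ≠ 0 := (lt_of_lt_of_le (zpow_pos card_pos_nnreal _) hle).ne'
    obtain ⟨j, hj1, hj2⟩ := NNReal.exists_mem_Ico_zpow ht0 hd1
    have h1 : -k < j + 1 := (zpow_lt_zpow_iff_right₀ hd1).1 (hle.trans_lt hj2)
    have h2 : j < n := by
      rw [← zpow_natCast] at ht
      exact (zpow_lt_zpow_iff_right₀ hd1).1 (hj1.trans_lt ht)
    have h3 := h ⟨(j + n).toNat, by omega⟩ (by simp only; omega)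
    rw [digits] at h3
    refine digit_ne_zero e hj1 hj2 ?_
    rw [← h3]
    congr 1
    simp only
    omega
  · intro h i hi
    exact digit_eq_zero_of_lt e (h.trans_le (zpow_le_zpow_right₀ hd1.le hi))

-- The extreme case of a tail of digits, which amounts to a full unit: it is the only way in which
-- `ι` can carry into the block.
omit [AddCommGroup A] [Finite A] in
lemma hasSum_maximal_tail (hd : 1 < Nat.card A) :
    HasSum (fun i : ℕ => ((Nat.card A - 1 : ℕ) : ℝ≥0) * (Nat.card A : ℝ≥0) ^ (-1 - (i : ℤ))) 1 := by
  have hd1 : (1 : ℝ) < Nat.card A := by exact_mod_cast hd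
  have hd0 : (Nat.card A : ℝ) ≠ 0 := by positivity
  have h := (hasSum_geometric_of_lt_one (r := (Nat.card A : ℝ)⁻¹) (by positivity)
    (inv_lt_one_of_one_lt₀ hd1)).mul_left (((Nat.card A : ℝ) - 1) * (Nat.card A : ℝ)⁻¹)
  rw [← NNReal.hasSum_coe]
  convert h using 1
  · rfl
  · funext i
    rw [NNReal.coe_mul, NNReal.coe_natCast, Nat.cast_sub hd.le, Nat.cast_one, NNReal.coe_zpow,
      NNReal.coe_natCast, zpow_sub₀ hd0, zpow_neg_one, zpow_natCast, inv_pow]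
    ring
  · have : (Nat.card A : ℝ) - 1 ≠ 0 := by linarith
    push_cast
    field_simp

/-- The integer part of `dⁿ ι(s)` for a sequence `s` whose digits below `-n` are not all
maximal. -/
lemma floor_iota (hd : 1 < Nat.card A) {n : ℕ} (s : seqGroup A)
    (hs : ∀ k : ℤ, (n : ℤ) ≤ k → (s : ℤ → A) k = 0)
    (hs' : ∃ i : ℕ, (e.toEquiv ((s : ℤ → A) (-(n : ℤ) - 1 - i)) : ℕ) ≠ Nat.card A - 1) :
    ⌊(Nat.card A : ℝ≥0) ^ n * iota e s⌋₊ = cellIndex e n fun i => (s : ℤ → A) ((i : ℤ) - n) := by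
  have hd0 : (Nat.card A : ℝ≥0) ≠ 0 := card_pos_nnreal.ne'
  set c : ℤ → ℕ := fun k => (e.toEquiv ((s : ℤ → A) k) : ℕ) with hc
  have hcle : ∀ k, c k ≤ Nat.card A - 1 := fun k => Nat.le_sub_one_of_lt (Fin.is_lt _)
  set T : ℕ → ℝ≥0 := fun i => (c (-(n : ℤ) - 1 - i) : ℝ≥0) * (Nat.card A : ℝ≥0) ^ (-1 - (i : ℤ))
    with hT
  have hmax := hasSum_maximal_tail (A := A) hd
  have hTle : ∀ i, T i ≤ ((Nat.card A - 1 : ℕ) : ℝ≥0) * (Nat.card A : ℝ≥0) ^ (-1 - (i : ℤ)) :=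
    fun i => mul_le_mul_of_nonneg_right (by exact_mod_cast hcle _) (zero_le)
  have hTs : Summable T := NNReal.summable_of_le hTle hmax.summable
  -- One non-maximal digit makes the comparison with the maximal tail strict, so nothing is carried.
  have hT1 : ∑' i, T i < 1 := by
    obtain ⟨i, hi⟩ := hs'
    rw [← hmax.tsum_eq]
    refine NNReal.tsum_lt_tsum hTle (i := i) ?_ hmax.summable
    refine mul_lt_mul_of_pos_right ?_ (zpow_pos card_pos_nnreal _)
    exact_mod_cast lt_of_le_of_ne (hcle _) hi
  let Fn : ℤ → ℝ≥0 := fun k => (c k : ℝ≥0) * (Nat.card A : ℝ≥0) ^ k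
  -- `g` lists the positions below the block and `g'` those in it; the digits above the block
  -- vanish.
  let g : ℕ → ℤ := fun i => -(n : ℤ) - 1 - i
  let g' : Fin (2 * n) → ℤ := fun i => (i : ℤ) - n
  have hg : Function.Injective g := fun i j h => by simp only [g] at h; omega
  have hg' : Function.Injective g' := fun i j h => by
    simp only [g'] at h
    exact Fin.ext (by omega)
  have h1 : HasSum ((Set.range g).indicator Fn) (((Nat.card A : ℝ≥0) ^ n)⁻¹ * ∑' i, T i) := by
    rw [← hg.hasSum_iff (fun x hx => Set.indicator_of_notMem hx _)]
    convert hTs.hasSum.mul_left (((Nat.card A : ℝ≥0) ^ n)⁻¹) using 1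
    · rfl
    funext i
    rw [Function.comp_apply, Set.indicator_of_mem (Set.mem_range_self i)]
    simp only [Fn, g, hT]
    rw [show -(n : ℤ) - 1 - i = (-1 - i) + (-(n : ℤ)) by ring, zpow_add₀ hd0, zpow_neg,
      zpow_natCast]
    ring
  have h2 : HasSum ((Set.range g').indicator Fn)
      (((Nat.card A : ℝ≥0) ^ n)⁻¹ * (cellIndex e n fun i => (s : ℤ → A) ((i : ℤ) - n) : ℕ)) := by
    rw [← hg'.hasSum_iff (fun x hx => Set.indicator_of_notMem hx _)]
    convert hasSum_fintype _ using 1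
    rw [cellIndex_apply, Nat.cast_sum, Finset.mul_sum]
    refine Finset.sum_congr rfl fun i _ => ?_
    rw [Function.comp_apply, Set.indicator_of_mem (Set.mem_range_self i)]
    simp only [Fn, g', hc]
    rw [zpow_sub₀ hd0, zpow_natCast, zpow_natCast]
    push_cast
    rw [div_eq_mul_inv]
    ring
  have h3 : (Set.range g).indicator Fn + (Set.range g').indicator Fn = Fn := by
    funext k
    rw [Pi.add_apply]
    rcases lt_or_ge k (-(n : ℤ)) with hk | hk
    · rw [Set.indicator_of_mem (show k ∈ Set.range g from ⟨(-(n : ℤ) - 1 - k).toNat, by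
        simp only [g]; omega⟩), Set.indicator_of_notMem, add_zero]
      rintro ⟨i, rfl⟩
      simp only [g'] at hk
      omega
    · have hkg : k ∉ Set.range g := by
        rintro ⟨i, rfl⟩
        simp only [g] at hk
        omega
      rw [Set.indicator_of_notMem hkg, zero_add]
      rcases lt_or_ge k n with hk' | hk'
      · rw [Set.indicator_of_mem]
        exact ⟨⟨(k + n).toNat, by omega⟩, by simp only [g']; omega⟩
      · rw [Set.indicator_of_notMem]
        · simp only [Fn, hc]
          rw [hs k hk', e.map_zero, Nat.cast_zero, zero_mul]
        · rintro ⟨i, rfl⟩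
          simp only [g'] at hk'
          have := i.2
          omega
  have h4 := h1.add h2
  change HasSum ((Set.range g).indicator Fn + (Set.range g').indicator Fn) _ at h4
  rw [h3] at h4
  have h5 : (Nat.card A : ℝ≥0) ^ n * iota e s
      = ∑' i, T i + (cellIndex e n fun i => (s : ℤ → A) ((i : ℤ) - n) : ℕ) := by
    have h6 : iota e s = _ := h4.tsum_eq
    rw [h6, ← mul_add, ← mul_assoc, mul_inv_cancel₀ (pow_ne_zero n hd0), one_mul]
  rw [h5, Nat.floor_add_natCast (zero_le), Nat.floor_eq_zero.2 hT1, zero_add]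

lemma mod_eq_of_digit_eq {t t' : ℝ≥0} {k : ℤ} (h : digit e t k = digit e t' k) :
    ⌊(Nat.card A : ℝ≥0) ^ (-k) * t⌋₊ % Nat.card A
      = ⌊(Nat.card A : ℝ≥0) ^ (-k) * t'⌋₊ % Nat.card A :=
  congrArg Fin.val (e.toEquiv.symm.injective h)

/-- Dividing `⌊d^(n+i+1) t⌋` by `d` leaves `⌊d^(n+i) t⌋` as quotient and one digit as remainder, so
all finer floors agree by induction. Distinct points are separated by some fine floor. -/
lemma eq_of_floor_eq_of_digit_eq (hd : 1 < Nat.card A) {n : ℕ} {t t' : ℝ≥0}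
    (h0 : ⌊(Nat.card A : ℝ≥0) ^ n * t⌋₊ = ⌊(Nat.card A : ℝ≥0) ^ n * t'⌋₊)
    (h : ∀ i : ℕ, digit e t (-(n : ℤ) - 1 - i) = digit e t' (-(n : ℤ) - 1 - i)) : t = t' := by
  have hd0 : (Nat.card A : ℝ≥0) ≠ 0 := card_pos_nnreal.ne'
  have key : ∀ i : ℕ, ⌊(Nat.card A : ℝ≥0) ^ (n + i) * t⌋₊
      = ⌊(Nat.card A : ℝ≥0) ^ (n + i) * t'⌋₊ := fun i => by
    induction i with
    | zero => exact h0
    | succ i ih =>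
      have h1 := mod_eq_of_digit_eq e (h i)
      rw [show -(-(n : ℤ) - 1 - i) = ((n + (i + 1) : ℕ) : ℤ) by push_cast; ring,
        zpow_natCast] at h1
      have h2 : ∀ t : ℝ≥0, ⌊(Nat.card A : ℝ≥0) ^ (n + (i + 1)) * t⌋₊ / Nat.card A
          = ⌊(Nat.card A : ℝ≥0) ^ (n + i) * t⌋₊ := fun t => by
        rw [← Nat.floor_div_natCast, ← add_assoc, pow_succ]
        congr 1
        field_simp
      rw [← Nat.div_add_mod ⌊(Nat.card A : ℝ≥0) ^ (n + (i + 1)) * t⌋₊ (Nat.card A),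
        ← Nat.div_add_mod ⌊(Nat.card A : ℝ≥0) ^ (n + (i + 1)) * t'⌋₊ (Nat.card A), h2, h2, h1, ih]
  have hlt : ∀ t t' : ℝ≥0, t < t' → ∃ i : ℕ, ⌊(Nat.card A : ℝ≥0) ^ (n + i) * t⌋₊
      ≠ ⌊(Nat.card A : ℝ≥0) ^ (n + i) * t'⌋₊ := fun t t' htt => by
    have hpos : 0 < t' - t := tsub_pos_of_lt htt
    obtain ⟨i, hi⟩ := pow_unbounded_of_one_lt (t' - t)⁻¹
      (show (1 : ℝ≥0) < Nat.card A by exact_mod_cast hd)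
    refine ⟨i, ne_of_lt ?_⟩
    rw [Nat.lt_iff_add_one_le]
    refine Nat.le_floor ?_
    have h1 : 1 ≤ (Nat.card A : ℝ≥0) ^ (n + i) * (t' - t) := by
      rw [← div_le_iff₀ hpos, one_div]
      refine hi.le.trans (pow_le_pow_right₀ (by exact_mod_cast hd.le) (Nat.le_add_left i n))
    calc ((⌊(Nat.card A : ℝ≥0) ^ (n + i) * t⌋₊ + 1 : ℕ) : ℝ≥0)
        = ⌊(Nat.card A : ℝ≥0) ^ (n + i) * t⌋₊ + 1 := by push_cast; rfl
      _ ≤ (Nat.card A : ℝ≥0) ^ (n + i) * t + (Nat.card A : ℝ≥0) ^ (n + i) * (t' - t) :=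
          add_le_add (Nat.floor_le (zero_le)) h1
      _ = _ := by rw [← mul_add, add_tsub_cancel_of_le htt.le]
  rcases lt_trichotomy t t' with htt | htt | htt
  · obtain ⟨i, hi⟩ := hlt t t' htt
    exact absurd (key i) hi
  · exact htt
  · obtain ⟨i, hi⟩ := hlt t' t htt
    exact absurd (key i).symm hi

/-- For fixed `x`, a maximal sum of tails prescribes every digit of `t` below the block. Then `⌊dⁿ
t⌋` determines `t`, so the exceptional set is countable. -/
lemma ae_digit_add_ne (hd : 1 < Nat.card A) (n : ℕ) (x : ℝ≥0) :
    ∀ᵐ t ∂halfLineVolume, ∃ i : ℕ,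
      (e.toEquiv (digit e x (-(n : ℤ) - 1 - i) + digit e t (-(n : ℤ) - 1 - i)) : ℕ)
        ≠ Nat.card A - 1 := by
  refine Set.Countable.measure_zero ?_ _
  refine Set.MapsTo.countable_of_injOn (f := fun t => ⌊(Nat.card A : ℝ≥0) ^ n * t⌋₊)
    (t := Set.univ) (Set.mapsTo_univ _ _) ?_ (Set.to_countable _)
  intro t ht t' ht' htt
  simp only [Set.mem_compl_iff, Set.mem_ofPred_eq, not_exists, not_not] at ht ht'
  refine eq_of_floor_eq_of_digit_eq e hd htt fun i => ?_
  have := Fin.ext ((ht i).trans (ht' i).symm)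
  exact add_left_cancel (e.toEquiv.injective this)

/-- Digitwise addition of blocks of digits. -/
lemma ae_oplus_mem_cell (hd : 1 < Nat.card A) {n : ℕ} {x : ℝ≥0}
    (hx : x < (Nat.card A : ℝ≥0) ^ n) :
    ∀ᵐ t ∂halfLineVolume, t < (Nat.card A : ℝ≥0) ^ n →
      oplus e x t ∈ cell e n (digits e n x + digits e n t) := by
  filter_upwards [ae_digit_add_ne e hd n x] with t ht htn
  rw [cell_eq]
  refine floor_iota e hd (kappa e x + kappa e t) (fun k hk => ?_) ht
  have h1 : (Nat.card A : ℝ≥0) ^ n ≤ (Nat.card A : ℝ≥0) ^ k := by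
    rw [← zpow_natCast]
    exact zpow_le_zpow_right₀ (by exact_mod_cast hd.le) hk
  change digit e x k + digit e t k = 0
  rw [digit_eq_zero_of_lt e (hx.trans_le h1), digit_eq_zero_of_lt e (htn.trans_le h1), add_zero]

end CantorGroup

/-! ### Step functions and the transfer of the finite bound. -/

namespace CantorGroup

open FiniteGroupAverages

variable {A : Type*} [AddCommGroup A] [Finite A] (e : DigitLabelling A)

/-- The square `[0, dⁿ)²`. -/
def square (A : Type*) (n : ℕ) : Set (ℝ≥0 × ℝ≥0) :=
  Set.Iio ((Nat.card A : ℝ≥0) ^ n) ×ˢ Set.Iio ((Nat.card A : ℝ≥0) ^ n)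

/-- The function on `[0, dⁿ)²`, extended by zero, that is given by a function of the blocks of
digits of the two coordinates. -/
def stepFun {E : Type*} [Zero E] (n : ℕ)
    (φ : (Fin (2 * n) → A) × (Fin (2 * n) → A) → E) : ℝ≥0 × ℝ≥0 → E :=
  (square A n).indicator fun z => φ (digits e n z.1, digits e n z.2)

lemma stepFun_of_mem {E : Type*} [Zero E] {n : ℕ}
    (φ : (Fin (2 * n) → A) × (Fin (2 * n) → A) → E) {z : ℝ≥0 × ℝ≥0} (hz : z ∈ square A n) :
    stepFun e n φ z = φ (digits e n z.1, digits e n z.2) :=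
  Set.indicator_of_mem hz _

lemma stepFun_of_notMem {E : Type*} [Zero E] {n : ℕ}
    (φ : (Fin (2 * n) → A) × (Fin (2 * n) → A) → E) {z : ℝ≥0 × ℝ≥0} (hz : z ∉ square A n) :
    stepFun e n φ z = 0 :=
  Set.indicator_of_notMem hz _

lemma comp_stepFun {E E' : Type*} [Zero E] [Zero E'] {n : ℕ}
    (φ : (Fin (2 * n) → A) × (Fin (2 * n) → A) → E) {g : E → E'} (hg : g 0 = 0) (z : ℝ≥0 × ℝ≥0) :
    g (stepFun e n φ z) = stepFun e n (g ∘ φ) z := by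
  by_cases hz : z ∈ square A n
  · rw [stepFun_of_mem e _ hz, stepFun_of_mem e _ hz, Function.comp_apply]
  · rw [stepFun_of_notMem e _ hz, stepFun_of_notMem e _ hz, hg]

lemma stepFun_eq_sum {E : Type*} [AddCommMonoid E] (n : ℕ) [Fintype (Fin (2 * n) → A)]
    (φ : (Fin (2 * n) → A) × (Fin (2 * n) → A) → E) (z : ℝ≥0 × ℝ≥0) :
    stepFun e n φ z
      = ∑ h : (Fin (2 * n) → A) × (Fin (2 * n) → A),
        (cell e n h.1 ×ˢ cell e n h.2).indicator (fun _ => φ h) z := by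
  classical
  by_cases hz : z ∈ square A n
  · rw [stepFun_of_mem e _ hz, Finset.sum_eq_single (digits e n z.1, digits e n z.2)]
    · rw [Set.indicator_of_mem]
      exact ⟨⟨hz.1, rfl⟩, ⟨hz.2, rfl⟩⟩
    · intro h _ hne
      refine Set.indicator_of_notMem (fun hm => hne ?_) _
      exact Prod.ext hm.1.2.symm hm.2.2.symm
    · simp
  · rw [stepFun_of_notMem e _ hz, eq_comm]
    exact Finset.sum_eq_zero fun h _ =>
      Set.indicator_of_notMem (fun hm => hz ⟨hm.1.1, hm.2.1⟩) _

lemma measurable_stepFun {E : Type*} [AddCommMonoid E] [MeasurableSpace E] [MeasurableAdd₂ E]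
    (n : ℕ) (φ : (Fin (2 * n) → A) × (Fin (2 * n) → A) → E) : Measurable (stepFun e n φ) := by
  classical
  have : Fintype A := Fintype.ofFinite A
  rw [show stepFun e n φ = _ from funext (stepFun_eq_sum e n φ)]
  exact Finset.measurable_fun_sum _ fun h _ => measurable_const.indicator
    ((measurableSet_cell e n _).prod (measurableSet_cell e n _))

lemma lintegral_stepFun (n : ℕ) [Fintype (Fin (2 * n) → A)]
    (φ : (Fin (2 * n) → A) × (Fin (2 * n) → A) → ℝ≥0∞) :
    ∫⁻ z, stepFun e n φ z ∂quarterPlaneVolume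
      = ((((Nat.card A : ℝ≥0) ^ n)⁻¹ : ℝ≥0) : ℝ≥0∞) ^ 2 * ∑ h, φ h := by
  simp_rw [stepFun_eq_sum]
  have hm : ∀ h : (Fin (2 * n) → A) × (Fin (2 * n) → A),
      MeasurableSet (cell e n h.1 ×ˢ cell e n h.2) :=
    fun h => (measurableSet_cell e n _).prod (measurableSet_cell e n _)
  rw [lintegral_finsetSum _ fun h _ => measurable_const.indicator (hm h), Finset.mul_sum]
  refine Finset.sum_congr rfl fun h _ => ?_
  rw [lintegral_indicator_const (hm h), quarterPlaneVolume, Measure.prod_prod,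
    halfLineVolume_cell, halfLineVolume_cell, mul_comm, sq]

lemma Ico_zero_eq_Iio (b : ℝ≥0) : Set.Ico 0 b = Set.Iio b := by
  ext t
  simp

/-- `F` is evaluated at an unmoved second coordinate and `G` at an unmoved first one, so one factor
vanishes wherever the translations land. -/
lemma bilinearAverage_eq_zero {n : ℕ} {F G : ℝ≥0 × ℝ≥0 → ℂ}
    (hF : ∀ z, z ∉ square A n → F z = 0) (hG : ∀ z, z ∉ square A n → G z = 0) (k : ℤ)
    {z : ℝ≥0 × ℝ≥0} (hz : z ∉ square A n) : bilinearAverage e k F G z = 0 := by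
  rw [bilinearAverage]
  have : ∀ t, F (oplus e z.1 t, z.2) * G (z.1, oplus e z.2 t) = 0 := fun t => by
    by_cases h1 : z.2 < (Nat.card A : ℝ≥0) ^ n
    · rw [hG (z.1, oplus e z.2 t) fun h => hz ⟨h.1, h1⟩, mul_zero]
    · rw [hF (oplus e z.1 t, z.2) fun h => h1 h.2, zero_mul]
  simp [this]

/-- The subgroup consists of the blocks of the cells that fill `[0, d⁻ᵏ)`; each cell has length
`d⁻ⁿ`. -/
lemma inv_card_blockSubgroup (hd : 1 < Nat.card A) {n : ℕ} {k : ℤ} (hk : -(n : ℤ) ≤ k) (hk' : k ≤ n) :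
    (Nat.card (blockSubgroup A n k) : ℂ)⁻¹ = (Nat.card A : ℂ) ^ k * ((Nat.card A : ℂ) ^ n)⁻¹ := by
  classical
  have : Fintype A := Fintype.ofFinite A
  -- The integral formula needs some labelling; a transposition makes any bijection send `0` to `0`.
  obtain ⟨e⟩ : Nonempty (DigitLabelling A) := by
    obtain ⟨e₀⟩ : Nonempty (A ≃ Fin (Nat.card A)) := ⟨Finite.equivFin A⟩
    have : NeZero (Nat.card A) := ⟨Nat.card_pos.ne'⟩
    exact ⟨⟨e₀.trans (Equiv.swap (e₀ 0) 0), by simp⟩⟩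
  have hd0 : (Nat.card A : ℂ) ≠ 0 := by exact_mod_cast Nat.card_pos.ne'
  have h1 := integral_comp_digits e n (fun h => if h ∈ blockSubgroup A n k then (1 : ℂ) else 0)
  have hsub : Set.Iio ((Nat.card A : ℝ≥0) ^ (-k)) ⊆ Set.Iio ((Nat.card A : ℝ≥0) ^ n) := by
    refine Set.Iio_subset_Iio ?_
    rw [← zpow_natCast]
    exact zpow_le_zpow_right₀ (by exact_mod_cast hd.le) (by omega)
  have h2 : ∫ t in Set.Iio ((Nat.card A : ℝ≥0) ^ n),
      (if digits e n t ∈ blockSubgroup A n k then (1 : ℂ) else 0) ∂halfLineVolume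
      = (Nat.card A : ℂ) ^ (-k) := by
    rw [setIntegral_congr_fun measurableSet_Iio
      (g := (Set.Iio ((Nat.card A : ℝ≥0) ^ (-k))).indicator fun _ => (1 : ℂ))]
    · rw [setIntegral_indicator measurableSet_Iio, Set.inter_eq_right.2 hsub, setIntegral_const,
        Measure.real, ← Ico_zero_eq_Iio, halfLineVolume_Ico, tsub_zero, ENNReal.coe_toReal]
      simp
    · intro t ht
      simp only [Set.indicator, Set.mem_Iio, digits_mem_blockSubgroup_iff e hd hk' ht]
  rw [h2, ← Finset.sum_filter, Finset.sum_const, nsmul_eq_mul, mul_one, ← Fintype.card_subtype,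
    ← Nat.card_eq_fintype_card] at h1
  rw [← inv_inv ((Nat.card A : ℂ) ^ k), ← zpow_neg, h1, mul_inv, inv_inv]
  change _ = _ * (Nat.card (blockSubgroup A n k) : ℂ)⁻¹ * _
  field_simp

/-- For almost every `t`, `⊕` adds the blocks of digits, so the integral over `[0, d⁻ᵏ)` is a sum
over the subgroup. The factor `dᵏ d⁻ⁿ` is the reciprocal of its order. -/
lemma bilinearAverage_stepFun (hd : 1 < Nat.card A) {n : ℕ} {k : ℤ} (hk : -(n : ℤ) ≤ k)
    (hk' : k ≤ n) [Fintype (Fin (2 * n) → A)]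
    (f g : (Fin (2 * n) → A) × (Fin (2 * n) → A) → ℂ) :
    bilinearAverage e k (stepFun e n f) (stepFun e n g)
      = stepFun e n (subgroupAverage (blockSubgroup A n k) f g) := by
  classical
  funext z
  by_cases hz : z ∈ square A n
  swap
  · rw [stepFun_of_notMem e _ hz]
    exact bilinearAverage_eq_zero e (fun _ => stepFun_of_notMem e _)
      (fun _ => stepFun_of_notMem e _) k hz
  obtain ⟨x, y⟩ := z
  obtain ⟨hx, hy⟩ : x < (Nat.card A : ℝ≥0) ^ n ∧ y < (Nat.card A : ℝ≥0) ^ n := id hz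
  rw [stepFun_of_mem e _ hz, subgroupAverage, bilinearAverage]
  simp only
  have hsub : Set.Iio ((Nat.card A : ℝ≥0) ^ (-k)) ⊆ Set.Iio ((Nat.card A : ℝ≥0) ^ n) := by
    refine Set.Iio_subset_Iio ?_
    rw [← zpow_natCast]
    exact zpow_le_zpow_right₀ (by exact_mod_cast hd.le) (by omega)
  let φ : (Fin (2 * n) → A) → ℂ := fun h => if h ∈ blockSubgroup A n k then
    f (digits e n x + h, digits e n y) * g (digits e n x, digits e n y + h) else 0
  have h1 : ∫ t in Set.Ico (0 : ℝ≥0) ((Nat.card A : ℝ≥0) ^ (-k)),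
      stepFun e n f (oplus e x t, y) * stepFun e n g (x, oplus e y t) ∂halfLineVolume
      = ∫ t in Set.Iio ((Nat.card A : ℝ≥0) ^ n), φ (digits e n t) ∂halfLineVolume := by
    rw [Ico_zero_eq_Iio, ← Set.inter_eq_right.2 hsub, ← setIntegral_indicator measurableSet_Iio]
    refine setIntegral_congr_ae measurableSet_Iio ?_
    filter_upwards [ae_oplus_mem_cell e hd hx, ae_oplus_mem_cell e hd hy] with t h1 h2 ht
    simp only [φ]
    by_cases htk : t < (Nat.card A : ℝ≥0) ^ (-k)
    · rw [Set.indicator_of_mem (Set.mem_Iio.2 htk),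
        if_pos ((digits_mem_blockSubgroup_iff e hd hk' ht).2 htk),
        stepFun_of_mem e _ (show (oplus e x t, y) ∈ square A n from ⟨(h1 ht).1, hy⟩),
        stepFun_of_mem e _ (show (x, oplus e y t) ∈ square A n from ⟨hx, (h2 ht).1⟩)]
      simp only [(h1 ht).2, (h2 ht).2]
    · rw [Set.indicator_of_notMem (show t ∉ Set.Iio _ from htk),
        if_neg (fun h => htk ((digits_mem_blockSubgroup_iff e hd hk' ht).1 h))]
  rw [h1, integral_comp_digits e n φ, ← mul_assoc, ← inv_card_blockSubgroup hd hk hk', Finset.mul_sum]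
  refine Finset.sum_congr rfl fun h _ => ?_
  simp only [φ, uniformDensity]
  split_ifs <;> simp

lemma enorm_rpow_eq_ofReal (w : ℂ) {q : ℝ} (hq : 0 ≤ q) :
    ‖w‖ₑ ^ q = ENNReal.ofReal (‖w‖ ^ q) := by
  rw [← ofReal_norm, ENNReal.ofReal_rpow_of_nonneg (norm_nonneg _) hq]

lemma lintegral_enorm_stepFun_rpow (n : ℕ) [Fintype (Fin (2 * n) → A)]
    (f : (Fin (2 * n) → A) × (Fin (2 * n) → A) → ℂ) {q : ℝ} (hq : 0 < q) :
    ∫⁻ z, ‖stepFun e n f z‖ₑ ^ q ∂quarterPlaneVolume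
      = ((((Nat.card A : ℝ≥0) ^ n)⁻¹ : ℝ≥0) : ℝ≥0∞) ^ 2 * ENNReal.ofReal (∑ h, ‖f h‖ ^ q) := by
  have h0 : (fun w : ℂ => ‖w‖ₑ ^ q) 0 = 0 := by simp [hq]
  rw [lintegral_congr (g := stepFun e n ((fun w : ℂ => ‖w‖ₑ ^ q) ∘ f))
    fun z => comp_stepFun e f h0 z, lintegral_stepFun,
    ENNReal.ofReal_sum_of_nonneg fun h _ => by positivity]
  congr 1
  exact Finset.sum_congr rfl fun h _ => enorm_rpow_eq_ofReal _ hq.le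

theorem lintegral_variation_stepFun_le (hd : 1 < Nat.card A) {p : ℝ} (hp : 2 ≤ p) {m : ℕ}
    {k : Fin (m + 1) → ℤ} (hk : Monotone k) {n : ℕ} (hn : ∀ j, -(n : ℤ) ≤ k j ∧ k j ≤ n)
    (f g : (Fin (2 * n) → A) × (Fin (2 * n) → A) → ℂ) :
    ∑ j : Fin m, ∫⁻ z, ‖bilinearAverage e (k j.succ) (stepFun e n f) (stepFun e n g) z
        - bilinearAverage e (k j.castSucc) (stepFun e n f) (stepFun e n g) z‖ₑ ^ p
          ∂quarterPlaneVolume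
      ≤ ENNReal.ofReal (2 ^ (p - 2) * 3)
        * (∫⁻ z, ‖stepFun e n f z‖ₑ ^ (2 * p) ∂quarterPlaneVolume) ^ (1 / 2 : ℝ)
        * (∫⁻ z, ‖stepFun e n g z‖ₑ ^ (2 * p) ∂quarterPlaneVolume) ^ (1 / 2 : ℝ) := by
  classical
  have : Fintype A := Fintype.ofFinite A
  have hp0 : 0 < p := by linarith
  set c : ℝ≥0∞ := ((((Nat.card A : ℝ≥0) ^ n)⁻¹ : ℝ≥0) : ℝ≥0∞) with hc
  have h1 : ∀ j : Fin m, ∫⁻ z, ‖bilinearAverage e (k j.succ) (stepFun e n f) (stepFun e n g) z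
        - bilinearAverage e (k j.castSucc) (stepFun e n f) (stepFun e n g) z‖ₑ ^ p
          ∂quarterPlaneVolume
      = c ^ 2 * ENNReal.ofReal (∑ h, ‖subgroupAverage (blockSubgroup A n (k j.succ)) f g h
        - subgroupAverage (blockSubgroup A n (k j.castSucc)) f g h‖ ^ p) := fun j => by
    rw [bilinearAverage_stepFun e hd (hn _).1 (hn _).2, bilinearAverage_stepFun e hd (hn _).1 (hn _).2,
      hc, ← lintegral_enorm_stepFun_rpow e n (fun h => subgroupAverage (blockSubgroup A n (k j.succ)) f g h
        - subgroupAverage (blockSubgroup A n (k j.castSucc)) f g h) hp0]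
    refine lintegral_congr fun z => ?_
    congr 2
    exact (congrFun (Set.indicator_sub _ _ _) z).symm
  have hS : ∀ f : (Fin (2 * n) → A) × (Fin (2 * n) → A) → ℂ, 0 ≤ ∑ h, ‖f h‖ ^ (2 * p) :=
    fun f => Finset.sum_nonneg fun h _ => by positivity
  simp_rw [h1]
  rw [← Finset.mul_sum, ← ENNReal.ofReal_sum_of_nonneg fun j _ => Finset.sum_nonneg fun h _ => by
    positivity, lintegral_enorm_stepFun_rpow e n f (by positivity),
    lintegral_enorm_stepFun_rpow e n g (by positivity), ← hc,
    ENNReal.mul_rpow_of_nonneg _ _ (by norm_num), ENNReal.mul_rpow_of_nonneg _ _ (by norm_num),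
    ENNReal.ofReal_rpow_of_nonneg (hS f) (by norm_num),
    ENNReal.ofReal_rpow_of_nonneg (hS g) (by norm_num)]
  -- The area `c ^ 2` of a cell of the plane appears once on the left and to the power `1/2` in each
  -- factor on the right, so it cancels.
  have hc2 : (c ^ 2) ^ (1 / 2 : ℝ) = c := by
    rw [← ENNReal.rpow_natCast, ← ENNReal.rpow_mul]
    norm_num
  rw [hc2]
  have h2 := ENNReal.ofReal_le_ofReal (sum_average_variation_rpow_le
    (fun j => blockSubgroup A n (k j)) ((antitone_blockSubgroup n).comp_monotone hk) hp f g)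
  rw [ENNReal.ofReal_mul (mul_nonneg (by positivity) (Real.rpow_nonneg (hS f) _)),
    ENNReal.ofReal_mul (by positivity)] at h2
  refine (mul_le_mul_right h2 _).trans (le_of_eq ?_)
  ring

end CantorGroup

/-! ### Invariance of the measure under `⊕` and convergence of the averages. -/

namespace CantorGroup

open Filter Topology

variable {A : Type*} [AddCommGroup A] [Finite A] (e : DigitLabelling A)

lemma measurable_oplus (x : ℝ≥0) : Measurable (oplus e x) := by
  refine Measurable.tsum fun k => Measurable.mul_const ?_ _
  have h1 : (fun t : ℝ≥0 => ((e.toEquiv (((kappa e x + kappa e t : seqGroup A) : ℤ → A) k) : ℕ) : ℝ≥0))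
      = (fun N : ℕ => ((e.toEquiv (digit e x k + e.toEquiv.symm
          ⟨N % Nat.card A, Nat.mod_lt _ Nat.card_pos⟩) : ℕ) : ℝ≥0))
        ∘ fun t : ℝ≥0 => ⌊(Nat.card A : ℝ≥0) ^ (-k) * t⌋₊ := rfl
  rw [h1]
  exact (measurable_of_countable _).comp (Nat.measurable_floor.comp (measurable_const_mul _))

lemma exists_cell_subset (hd : 1 < Nat.card A) (n₀ : ℕ) {U : Set ℝ≥0} (hU : IsOpen U) {y : ℝ≥0}
    (hy : y ∈ U) : ∃ n ≥ n₀, ∃ h, cell e n h ⊆ U ∧ y ∈ cell e n h := by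
  have hd1 : (1 : ℝ) < Nat.card A := by exact_mod_cast hd
  obtain ⟨ε, hε, hball⟩ := Metric.isOpen_iff.1 hU y hy
  obtain ⟨n₁, hn₁⟩ := pow_unbounded_of_one_lt ε⁻¹ hd1
  obtain ⟨n₂, hn₂⟩ := pow_unbounded_of_one_lt (y : ℝ) hd1
  set n := max n₀ (max n₁ n₂) with hn
  have h1 : ε⁻¹ < (Nat.card A : ℝ) ^ n := hn₁.trans_le (pow_le_pow_right₀ hd1.le (by omega))
  have h2 : y < (Nat.card A : ℝ≥0) ^ n := by
    have : (y : ℝ) < (Nat.card A : ℝ) ^ n := hn₂.trans_le (pow_le_pow_right₀ hd1.le (by omega))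
    exact_mod_cast this
  have hyc : y ∈ cell e n (digits e n y) := ⟨h2, rfl⟩
  refine ⟨n, le_max_left _ _, digits e n y, fun t ht => hball ?_, hyc⟩
  have hpos : (0 : ℝ) < (Nat.card A : ℝ) ^ n := by positivity
  rw [cell_eq_Ico] at ht hyc
  obtain ⟨a1, a2⟩ := ht
  obtain ⟨b1, b2⟩ := hyc
  rw [← NNReal.coe_le_coe] at a1 b1
  rw [← NNReal.coe_lt_coe] at a2 b2
  push_cast at a1 a2 b1 b2
  rw [add_div] at a2 b2
  have h3 : 1 / (Nat.card A : ℝ) ^ n < ε := by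
    rw [one_div]
    exact inv_lt_of_inv_lt₀ hε h1
  rw [Metric.mem_ball, NNReal.dist_eq, abs_lt]
  constructor <;> linarith

lemma cell_inter_cell {n n' : ℕ} (hn : n ≤ n') {h : Fin (2 * n) → A} {h' : Fin (2 * n') → A}
    (hne : (cell e n h ∩ cell e n' h').Nonempty) : cell e n h ∩ cell e n' h' = cell e n' h' := by
  obtain ⟨t, ht, ht'⟩ := hne
  refine Set.inter_eq_right.2 fun s hs => ?_
  rw [cell_eq] at ht ht' hs ⊢
  have hd0 : (Nat.card A : ℝ≥0) ≠ 0 := card_pos_nnreal.ne'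
  have h2 : ∀ t : ℝ≥0, ⌊(Nat.card A : ℝ≥0) ^ n * t⌋₊
      = ⌊(Nat.card A : ℝ≥0) ^ n' * t⌋₊ / Nat.card A ^ (n' - n) := fun t => by
    rw [← Nat.floor_div_natCast]
    congr 1
    push_cast
    rw [← Nat.add_sub_cancel' hn, pow_add, Nat.add_sub_cancel_left]
    field_simp
  simp only [Set.mem_ofPred_eq] at ht ht' hs ⊢
  rw [h2, hs, ← ht', ← h2, ht]

/-- With `cell_inter_cell`, this makes the cells a generating π-system. Only scales `≥ n₀` are used,
so that a given point of `[0, d^n₀)` lies in every block range considered. -/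
lemma generateFrom_cell (hd : 1 < Nat.card A) (n₀ : ℕ) :
    (inferInstance : MeasurableSpace ℝ≥0)
      = MeasurableSpace.generateFrom {S | ∃ n ≥ n₀, ∃ h, S = cell e n h} := by
  apply le_antisymm
  · rw [BorelSpace.measurable_eq (α := ℝ≥0)]
    refine MeasurableSpace.generateFrom_le fun U hU => ?_
    have h1 : U = ⋃ q : {q : (n : ℕ) × (Fin (2 * n) → A) // n₀ ≤ q.1 ∧ cell e q.1 q.2 ⊆ U},
        cell e q.1.1 q.1.2 := by
      apply Set.Subset.antisymm
      · intro y hy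
        obtain ⟨n, hn, h, hsub, hyc⟩ := exists_cell_subset e hd n₀ hU hy
        exact Set.mem_iUnion.2 ⟨⟨⟨n, h⟩, hn, hsub⟩, hyc⟩
      · exact Set.iUnion_subset fun q => q.2.2
    rw [h1]
    exact MeasurableSet.iUnion fun q =>
      MeasurableSpace.measurableSet_generateFrom ⟨_, q.2.1, _, rfl⟩
  · refine MeasurableSpace.generateFrom_le ?_
    rintro _ ⟨n, -, h, rfl⟩
    exact measurableSet_cell e n h

lemma cell_inter_Iio (hd : 1 < Nat.card A) {n n' : ℕ} (h : Fin (2 * n') → A) :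
    (h ∈ blockSubgroup A n' (-n) → cell e n' h ⊆ Set.Iio ((Nat.card A : ℝ≥0) ^ n)) ∧
      (h ∉ blockSubgroup A n' (-n) → cell e n' h ∩ Set.Iio ((Nat.card A : ℝ≥0) ^ n) = ∅) := by
  have key : ∀ t ∈ cell e n' h, h ∈ blockSubgroup A n' (-n) ↔ t < (Nat.card A : ℝ≥0) ^ n := by
    rintro t ⟨ht, rfl⟩
    rw [digits_mem_blockSubgroup_iff e hd (by omega) ht, neg_neg, zpow_natCast]
  refine ⟨fun hh t ht => (key t ht).1 hh, fun hh => ?_⟩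
  ext t
  simp only [Set.mem_inter_iff, Set.mem_empty_iff_false, iff_false, not_and]
  exact fun ht ht' => hh ((key t ht).2 ht')

/-- Digitwise translations preserve Lebesgue measure. -/
lemma map_oplus (hd : 1 < Nat.card A) {n : ℕ} {x : ℝ≥0} (hx : x < (Nat.card A : ℝ≥0) ^ n) :
    (halfLineVolume.restrict (Set.Iio ((Nat.card A : ℝ≥0) ^ n))).map (oplus e x)
      = halfLineVolume.restrict (Set.Iio ((Nat.card A : ℝ≥0) ^ n)) := by
  set ν := halfLineVolume.restrict (Set.Iio ((Nat.card A : ℝ≥0) ^ n)) with hν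
  have hfin : IsFiniteMeasure ν := by
    refine ⟨?_⟩
    rw [hν, Measure.restrict_apply_univ, ← Ico_zero_eq_Iio, halfLineVolume_Ico]
    exact ENNReal.coe_lt_top
  symm
  refine ext_of_generate_finite _ (generateFrom_cell e hd n) ?_ ?_ ?_
  · rintro _ ⟨n₁, h₁, a, rfl⟩ _ ⟨n₂, h₂, b, rfl⟩ hne
    rcases le_total n₁ n₂ with hle | hle
    · rw [cell_inter_cell e hle hne]
      exact ⟨n₂, h₂, b, rfl⟩
    · rw [Set.inter_comm] at hne ⊢
      rw [cell_inter_cell e hle hne]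
      exact ⟨n₁, h₁, a, rfl⟩
  · rintro _ ⟨N, hN, h, rfl⟩
    have hxN : x < (Nat.card A : ℝ≥0) ^ N :=
      hx.trans_le (pow_le_pow_right₀ (by exact_mod_cast hd.le) hN)
    have hdx : digits e N x ∈ blockSubgroup A N (-n) := by
      rw [digits_mem_blockSubgroup_iff e hd (by omega) hxN, neg_neg, zpow_natCast]
      exact hx
    rw [Measure.map_apply (measurable_oplus e x) (measurableSet_cell e N h)]
    -- Almost everywhere `⊕ x` adds the block of `x`, so the preimage of a cell is the cell of the
    -- shifted block.
    have h1 : ν (oplus e x ⁻¹' cell e N h) = ν (cell e N (h - digits e N x)) := by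
      refine measure_congr ?_
      rw [hν]
      filter_upwards [ae_restrict_of_ae (ae_oplus_mem_cell e hd hxN),
        ae_restrict_mem measurableSet_Iio] with t ht htn
      have htN : t < (Nat.card A : ℝ≥0) ^ N :=
        (Set.mem_Iio.1 htn).trans_le (pow_le_pow_right₀ (by exact_mod_cast hd.le) hN)
      refine propext ?_
      change oplus e x t ∈ cell e N h ↔ t ∈ cell e N (h - digits e N x)
      constructor
      · intro hh
        refine ⟨htN, ?_⟩
        rw [← hh.2, (ht htN).2, add_sub_cancel_left]
      · intro hh
        refine ⟨(ht htN).1, ?_⟩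
        rw [(ht htN).2, hh.2, add_sub_cancel]
    rw [h1, hν, Measure.restrict_apply (measurableSet_cell e N _),
      Measure.restrict_apply (measurableSet_cell e N _)]
    -- The block of `x` lies in the subgroup, so both cells lie inside `[0, dⁿ)` or both lie outside
    -- it.
    by_cases hh : h ∈ blockSubgroup A N (-n)
    · rw [Set.inter_eq_left.2 ((cell_inter_Iio e hd h).1 hh),
        Set.inter_eq_left.2 ((cell_inter_Iio e hd _).1 (sub_mem hh hdx)),
        halfLineVolume_cell, halfLineVolume_cell]
    · rw [(cell_inter_Iio e hd h).2 hh, (cell_inter_Iio e hd _).2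
        fun h' => hh (by simpa using add_mem h' hdx)]
  · rw [Measure.map_apply (measurable_oplus e x) MeasurableSet.univ, Set.preimage_univ]

/-- Convergence almost everywhere in a coordinate passes to convergence for almost every translation
parameter. -/
lemma ae_oplus (hd : 1 < Nat.card A) {n : ℕ} {x : ℝ≥0} (hx : x < (Nat.card A : ℝ≥0) ^ n)
    {P : ℝ≥0 → Prop} (hP : ∀ᵐ t ∂halfLineVolume, P t) :
    ∀ᵐ t ∂halfLineVolume.restrict (Set.Iio ((Nat.card A : ℝ≥0) ^ n)), P (oplus e x t) := by
  have h := ae_restrict_of_ae (s := Set.Iio ((Nat.card A : ℝ≥0) ^ n)) hP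
  rw [← map_oplus e hd hx] at h
  exact ae_of_ae_map (measurable_oplus e x).aemeasurable h

/-- Pointwise convergence of the bilinear averages under bounded almost everywhere convergence. -/
lemma ae_tendsto_bilinearAverage (hd : 1 < Nat.card A) {n : ℕ} {k : ℤ} (hk : -(n : ℤ) ≤ k)
    {F G : ℝ≥0 × ℝ≥0 → ℂ} {F' G' : ℕ → ℝ≥0 × ℝ≥0 → ℂ} {M : ℝ}
    (hF'm : ∀ i, Measurable (F' i)) (hG'm : ∀ i, Measurable (G' i))
    (hF'M : ∀ i z, ‖F' i z‖ ≤ M) (hG'M : ∀ i z, ‖G' i z‖ ≤ M)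
    (hF : ∀ᵐ z ∂quarterPlaneVolume, Tendsto (fun i => F' i z) atTop (𝓝 (F z)))
    (hG : ∀ᵐ z ∂quarterPlaneVolume, Tendsto (fun i => G' i z) atTop (𝓝 (G z))) :
    ∀ᵐ z ∂quarterPlaneVolume, z ∈ square A n →
      Tendsto (fun i => bilinearAverage e k (F' i) (G' i) z) atTop
        (𝓝 (bilinearAverage e k F G z)) := by
  -- The first coordinate of `F` is translated with `y` fixed, so Fubini is applied after a swap;
  -- for `G` the order is the original one.
  have hF2 : ∀ᵐ y ∂halfLineVolume, ∀ᵐ x ∂halfLineVolume,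
      Tendsto (fun i => F' i (x, y)) atTop (𝓝 (F (x, y))) := by
    have h1 : ∀ᵐ z ∂(halfLineVolume.prod halfLineVolume).map Prod.swap,
        Tendsto (fun i => F' i z) atTop (𝓝 (F z)) := by
      rw [Measure.prod_swap]
      exact hF
    exact Measure.ae_ae_of_ae_prod (ae_of_ae_map measurable_swap.aemeasurable h1)
  have hG2 : ∀ᵐ x ∂halfLineVolume, ∀ᵐ y ∂halfLineVolume,
      Tendsto (fun i => G' i (x, y)) atTop (𝓝 (G (x, y))) := Measure.ae_ae_of_ae_prod hG
  have hsub : Set.Ico 0 ((Nat.card A : ℝ≥0) ^ (-k)) ⊆ Set.Iio ((Nat.card A : ℝ≥0) ^ n) := by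
    rw [Ico_zero_eq_Iio]
    refine Set.Iio_subset_Iio ?_
    rw [← zpow_natCast]
    exact zpow_le_zpow_right₀ (by exact_mod_cast hd.le) (by omega)
  filter_upwards [Measure.quasiMeasurePreserving_snd.ae hF2,
    Measure.quasiMeasurePreserving_fst.ae hG2] with z hz1 hz2 hz
  unfold bilinearAverage
  refine Tendsto.const_mul _ ?_
  have hfin : IsFiniteMeasure (halfLineVolume.restrict
      (Set.Ico 0 ((Nat.card A : ℝ≥0) ^ (-k)))) := by
    refine ⟨?_⟩
    rw [Measure.restrict_apply_univ, halfLineVolume_Ico]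
    exact ENNReal.coe_lt_top
  refine tendsto_integral_of_dominated_convergence (fun _ => M * M) (fun i => ?_)
    (integrable_const _) (fun i => ae_of_all _ fun t => ?_) ?_
  · exact (((hF'm i).comp ((measurable_oplus e _).prodMk measurable_const)).mul
      ((hG'm i).comp (measurable_const.prodMk (measurable_oplus e _)))).aestronglyMeasurable
  · rw [norm_mul]
    exact mul_le_mul (hF'M i _) (hG'M i _) (norm_nonneg _) ((norm_nonneg _).trans (hF'M i z))
  · filter_upwards [ae_restrict_of_ae_restrict_of_subset hsub (ae_oplus e hd hz.1 hz1),
      ae_restrict_of_ae_restrict_of_subset hsub (ae_oplus e hd hz.2 hz2)] with t h1 h2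
    exact h1.mul h2

end CantorGroup

/-! ### Approximation by step functions through martingale convergence. -/

namespace CantorGroup

open Filter Topology

/-- The grid cell of side `d⁻ⁿ` that contains a given point. -/
def gridMap (A : Type*) (n : ℕ) (z : ℝ≥0 × ℝ≥0) : ℕ × ℕ :=
  (⌊(Nat.card A : ℝ≥0) ^ n * z.1⌋₊, ⌊(Nat.card A : ℝ≥0) ^ n * z.2⌋₊)

lemma measurable_gridMap (A : Type*) (n : ℕ) : Measurable (gridMap A n) :=
  (Nat.measurable_floor.comp (measurable_fst.const_mul _)).prodMk
    (Nat.measurable_floor.comp (measurable_snd.const_mul _))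

section

variable {A : Type*} [AddCommGroup A] [Finite A]

/-- The filtration of the grids of side `d⁻ⁿ`. -/
def gridFiltration (A : Type*) [AddCommGroup A] [Finite A] :
    Filtration ℕ (inferInstance : MeasurableSpace (ℝ≥0 × ℝ≥0)) where
  seq n := MeasurableSpace.comap (gridMap A n) inferInstance
  mono' := fun n n' hn => by
    have hd0 : (Nat.card A : ℝ≥0) ≠ 0 := card_pos_nnreal.ne'
    have h2 : ∀ t : ℝ≥0, ⌊(Nat.card A : ℝ≥0) ^ n * t⌋₊
        = ⌊(Nat.card A : ℝ≥0) ^ n' * t⌋₊ / Nat.card A ^ (n' - n) := fun t => by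
      rw [← Nat.floor_div_natCast]
      congr 1
      push_cast
      rw [← Nat.add_sub_cancel' hn, pow_add, Nat.add_sub_cancel_left]
      field_simp
    have h3 : gridMap A n = (fun a : ℕ × ℕ =>
        (a.1 / Nat.card A ^ (n' - n), a.2 / Nat.card A ^ (n' - n))) ∘ gridMap A n' := by
      funext z
      simp only [gridMap, Function.comp_apply, h2 z.1, h2 z.2]
    change MeasurableSpace.comap (gridMap A n) _ ≤ _
    rw [h3, ← MeasurableSpace.comap_comp]
    exact MeasurableSpace.comap_mono (measurable_of_countable _).comap_le
  le' n := (measurable_gridMap A n).comap_le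

lemma measurable_gridMap_iSup (n : ℕ) :
    Measurable[⨆ n, gridFiltration A n] (gridMap A n) :=
  (comap_measurable (gridMap A n)).mono (le_iSup (fun n => gridFiltration A n) n) le_rfl

omit [AddCommGroup A] [Finite A] in
lemma tendsto_floor_div_pow (hd : 1 < Nat.card A) (t : ℝ≥0) :
    Tendsto (fun n : ℕ => (⌊(Nat.card A : ℝ≥0) ^ n * t⌋₊ : ℝ≥0) / (Nat.card A : ℝ≥0) ^ n) atTop
      (𝓝 t) := by
  have hd1 : (1 : ℝ) < Nat.card A := by exact_mod_cast hd
  have h1 := (tendsto_nat_floor_mul_div_atTop (R := ℝ) (a := (t : ℝ)) t.2).comp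
    (tendsto_pow_atTop_atTop_of_one_lt hd1)
  rw [← NNReal.tendsto_coe]
  refine h1.congr fun n => ?_
  have h2 : ⌊(t : ℝ) * (Nat.card A : ℝ) ^ n⌋₊ = ⌊(Nat.card A : ℝ≥0) ^ n * t⌋₊ := by
    refine (Nat.floor_eq_iff (by positivity)).2 ?_
    have h3 := (Nat.floor_eq_iff (a := (Nat.card A : ℝ≥0) ^ n * t) zero_le).1 rfl
    rw [mul_comm (t : ℝ)]
    exact_mod_cast h3
  rw [Function.comp_apply, h2]
  push_cast
  rfl

/-- Each coordinate is the limit of `⌊dⁿ t⌋ / dⁿ`, which the `n`-th grid determines. -/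
lemma iSup_gridFiltration (hd : 1 < Nat.card A) :
    (⨆ n, gridFiltration A n) = (inferInstance : MeasurableSpace (ℝ≥0 × ℝ≥0)) := by
  refine le_antisymm (iSup_le fun n => (gridFiltration A).le n) ?_
  have h1 : Measurable[⨆ n, gridFiltration A n] (Prod.fst : ℝ≥0 × ℝ≥0 → ℝ≥0) :=
    @measurable_of_tendsto_metrizable _ _ (⨆ n, gridFiltration A n) _ _ _ _ _ _
      (fun n => ((measurable_of_countable
        (fun a : ℕ × ℕ => (a.1 : ℝ≥0) / (Nat.card A : ℝ≥0) ^ n)).comp (measurable_gridMap_iSup n)))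
      (tendsto_pi_nhds.2 fun z => tendsto_floor_div_pow hd z.1)
  have h2 : Measurable[⨆ n, gridFiltration A n] (Prod.snd : ℝ≥0 × ℝ≥0 → ℝ≥0) :=
    @measurable_of_tendsto_metrizable _ _ (⨆ n, gridFiltration A n) _ _ _ _ _ _
      (fun n => ((measurable_of_countable
        (fun a : ℕ × ℕ => (a.2 : ℝ≥0) / (Nat.card A : ℝ≥0) ^ n)).comp (measurable_gridMap_iSup n)))
      (tendsto_pi_nhds.2 fun z => tendsto_floor_div_pow hd z.2)
  exact sup_le h1.comap_le h2.comap_le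

/-- Conditional expectations on the grids converge almost everywhere by Lévy's upward theorem.
Truncation at `±M` makes the bound hold everywhere and does not affect the limit. -/
lemma exists_grid_approximation_real (hd : 1 < Nat.card A) (μ : Measure (ℝ≥0 × ℝ≥0))
    [IsFiniteMeasure μ] {F : ℝ≥0 × ℝ≥0 → ℝ} (hF : Measurable F) {M : ℝ} (hM : ∀ z, |F z| ≤ M) :
    ∃ φ : ℕ → ℕ × ℕ → ℝ, (∀ n a, |φ n a| ≤ M) ∧
      ∀ᵐ z ∂μ, Tendsto (fun n => φ n (gridMap A n z)) atTop (𝓝 (F z)) := by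
  have h1 : ∀ n, ∃ φ : ℕ × ℕ → ℝ, Measurable φ ∧ μ[F | gridFiltration A n] = φ ∘ gridMap A n :=
    fun n => (stronglyMeasurable_condExp (m := gridFiltration A n)).measurable.exists_eq_measurable_comp
  choose φ _ hφ using h1
  have hM0 : 0 ≤ M := (abs_nonneg _).trans (hM 0)
  refine ⟨fun n a => max (-M) (min (φ n a) M), fun n a => abs_le.2 ⟨le_max_left _ _,
    max_le (by linarith) (min_le_right _ _)⟩, ?_⟩
  have hint : Integrable F μ := Integrable.of_bound hF.aestronglyMeasurable M (ae_of_all _ hM)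
  have hsm : StronglyMeasurable[⨆ n, gridFiltration A n] F := by
    rw [iSup_gridFiltration hd]
    exact hF.stronglyMeasurable
  filter_upwards [hint.tendsto_ae_condExp hsm] with z hz
  have h2 : Tendsto (fun n => max (-M) (min ((μ[F | gridFiltration A n]) z) M)) atTop
      (𝓝 (max (-M) (min (F z) M))) := tendsto_const_nhds.max (hz.min tendsto_const_nhds)
  rw [min_eq_left (abs_le.1 (hM z)).2, max_eq_right (abs_le.1 (hM z)).1] at h2
  refine h2.congr fun n => ?_
  rw [hφ]
  rfl

lemma exists_grid_approximation (hd : 1 < Nat.card A) (μ : Measure (ℝ≥0 × ℝ≥0))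
    [IsFiniteMeasure μ] {F : ℝ≥0 × ℝ≥0 → ℂ} (hF : Measurable F) {M : ℝ} (hM : ∀ z, ‖F z‖ ≤ M) :
    ∃ φ : ℕ → ℕ × ℕ → ℂ, (∀ n a, ‖φ n a‖ ≤ M + M) ∧
      ∀ᵐ z ∂μ, Tendsto (fun n => φ n (gridMap A n z)) atTop (𝓝 (F z)) := by
  obtain ⟨φ, hφ, hφF⟩ := exists_grid_approximation_real hd μ (Complex.measurable_re.comp hF)
    (fun z => (Complex.abs_re_le_norm _).trans (hM z))
  obtain ⟨ψ, hψ, hψF⟩ := exists_grid_approximation_real hd μ (Complex.measurable_im.comp hF)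
    (fun z => (Complex.abs_im_le_norm _).trans (hM z))
  refine ⟨fun n a => φ n a + ψ n a * Complex.I, fun n a => (norm_add_le _ _).trans ?_, ?_⟩
  · rw [norm_mul, Complex.norm_I, mul_one, Complex.norm_real, Complex.norm_real]
    exact add_le_add (hφ n a) (hψ n a)
  · filter_upwards [hφF, hψF] with z h1 h2
    have h3 := ((Complex.continuous_ofReal.tendsto _).comp h1).add
      (((Complex.continuous_ofReal.tendsto _).comp h2).mul_const Complex.I)
    simp only [Function.comp_apply, Complex.re_add_im] at h3
    exact h3

variable (e : DigitLabelling A)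

/-- A grid function that is cut off to a square is a step function. -/
lemma indicator_square_comp_gridMap (hd : 1 < Nat.card A) {n₀ n : ℕ} (hn : n₀ ≤ n)
    (φ : ℕ × ℕ → ℂ) :
    ∃ f, (square A n₀).indicator (fun z => φ (gridMap A n z)) = stepFun e n f := by
  classical
  -- Vanishing digits at positions `≥ n₀` encode the smaller square, so the support stays fixed
  -- while the grid is refined.
  refine ⟨fun h => if h.1 ∈ blockSubgroup A n (-n₀) ∧ h.2 ∈ blockSubgroup A n (-n₀) then
    φ (cellIndex e n h.1, cellIndex e n h.2) else 0, ?_⟩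
  funext z
  have hle : (Nat.card A : ℝ≥0) ^ n₀ ≤ (Nat.card A : ℝ≥0) ^ n :=
    pow_le_pow_right₀ (by exact_mod_cast hd.le) hn
  by_cases hz : z ∈ square A n
  · obtain ⟨h1, h2⟩ : z.1 < (Nat.card A : ℝ≥0) ^ n ∧ z.2 < (Nat.card A : ℝ≥0) ^ n := id hz
    rw [stepFun_of_mem e _ hz]
    simp only
    rw [digits_mem_blockSubgroup_iff e hd (by omega) h1,
      digits_mem_blockSubgroup_iff e hd (by omega) h2, neg_neg, zpow_natCast, cellIndex_digits e h1,
      cellIndex_digits e h2]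
    by_cases hz₀ : z ∈ square A n₀
    · rw [Set.indicator_of_mem hz₀]
      exact (if_pos hz₀).symm
    · rw [Set.indicator_of_notMem hz₀]
      exact (if_neg hz₀).symm
  · rw [stepFun_of_notMem e _ hz, Set.indicator_of_notMem]
    exact fun h => hz ⟨lt_of_lt_of_le h.1 hle, lt_of_lt_of_le h.2 hle⟩

omit [AddCommGroup A] [Finite A] in
lemma quarterPlaneVolume_square_ne_top (n : ℕ) : quarterPlaneVolume (square A n) ≠ ∞ := by
  rw [square, quarterPlaneVolume, Measure.prod_prod, ← Ico_zero_eq_Iio, halfLineVolume_Ico]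
  exact ENNReal.mul_ne_top ENNReal.coe_ne_top ENNReal.coe_ne_top

omit [AddCommGroup A] [Finite A] in
lemma measurableSet_square (n : ℕ) : MeasurableSet (square A n) :=
  measurableSet_Iio.prod measurableSet_Iio

/-- Approximation of bounded functions with bounded support by step functions. -/
lemma exists_stepFun_approximation (hd : 1 < Nat.card A) {F : ℝ≥0 × ℝ≥0 → ℂ} (hF : Measurable F)
    {M : ℝ} (hM : ∀ z, ‖F z‖ ≤ M) {n₀ : ℕ} (hsupp : ∀ z, z ∉ square A n₀ → F z = 0) :
    ∃ f : ∀ n, (Fin (2 * n) → A) × (Fin (2 * n) → A) → ℂ,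
      (∀ n ≥ n₀, ∀ z, ‖stepFun e n (f n) z‖ ≤ M + M) ∧
      (∀ n ≥ n₀, ∀ z, z ∉ square A n₀ → stepFun e n (f n) z = 0) ∧
      ∀ᵐ z ∂quarterPlaneVolume,
        Tendsto (fun n => stepFun e n (f n) z) atTop (𝓝 (F z)) := by
  have hM0 : 0 ≤ M := (norm_nonneg _).trans (hM 0)
  have hfin : IsFiniteMeasure (quarterPlaneVolume.restrict (square A n₀)) :=
    ⟨by rw [Measure.restrict_apply_univ]; exact (quarterPlaneVolume_square_ne_top n₀).lt_top⟩
  obtain ⟨φ, hφ, hlim⟩ := exists_grid_approximation (A := A) hd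
    (quarterPlaneVolume.restrict (square A n₀)) hF hM
  have h1 : ∀ n, ∃ f, n₀ ≤ n →
      (square A n₀).indicator (fun z => φ n (gridMap A n z)) = stepFun e n f := fun n => by
    by_cases hn : n₀ ≤ n
    · obtain ⟨f, hf⟩ := indicator_square_comp_gridMap e hd hn (φ n)
      exact ⟨f, fun _ => hf⟩
    · exact ⟨0, fun h => absurd h hn⟩
  choose f hf using h1
  refine ⟨f, fun n hn z => ?_, fun n hn z hz => ?_, ?_⟩
  · rw [← hf n hn]
    by_cases hz : z ∈ square A n₀
    · rw [Set.indicator_of_mem hz]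
      exact hφ n _
    · rw [Set.indicator_of_notMem hz, norm_zero]
      positivity
  · rw [← hf n hn, Set.indicator_of_notMem hz]
  · rw [ae_restrict_iff' (measurableSet_square n₀)] at hlim
    filter_upwards [hlim] with z hz
    have h2 : Tendsto (fun n => (square A n₀).indicator (fun z => φ n (gridMap A n z)) z) atTop
        (𝓝 (F z)) := by
      by_cases hzs : z ∈ square A n₀
      · simp only [Set.indicator_of_mem hzs]
        exact hz hzs
      · simp only [Set.indicator_of_notMem hzs, hsupp z hzs]
        exact tendsto_const_nhds
    refine h2.congr' ?_
    filter_upwards [eventually_ge_atTop n₀] with n hn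
    rw [hf n hn]

end

end CantorGroup

/-! ### Passage to the limit. -/

namespace CantorGroup

open Filter Topology

variable {A : Type*} [AddCommGroup A] [Finite A] (e : DigitLabelling A)

lemma measurable_bilinearAverage_stepFun (hd : 1 < Nat.card A) {n : ℕ} {k : ℤ}
    (hk : -(n : ℤ) ≤ k) (hk' : k ≤ n) (f g : (Fin (2 * n) → A) × (Fin (2 * n) → A) → ℂ) :
    Measurable (bilinearAverage e k (stepFun e n f) (stepFun e n g)) := by
  classical
  have : Fintype A := Fintype.ofFinite A
  rw [bilinearAverage_stepFun e hd hk hk']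
  exact measurable_stepFun e n _

omit [AddCommGroup A] [Finite A] in
lemma tendsto_lintegral_enorm_rpow {n₀ : ℕ} {F : ℝ≥0 × ℝ≥0 → ℂ} {F' : ℕ → ℝ≥0 × ℝ≥0 → ℂ} {M : ℝ}
    (hF'm : ∀ i, Measurable (F' i)) (hF'M : ∀ i z, ‖F' i z‖ ≤ M)
    (hF's : ∀ i z, z ∉ square A n₀ → F' i z = 0)
    (hF : ∀ᵐ z ∂quarterPlaneVolume, Tendsto (fun i => F' i z) atTop (𝓝 (F z))) {q : ℝ}
    (hq : 0 < q) :
    Tendsto (fun i => ∫⁻ z, ‖F' i z‖ₑ ^ q ∂quarterPlaneVolume) atTop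
      (𝓝 (∫⁻ z, ‖F z‖ₑ ^ q ∂quarterPlaneVolume)) ∧
    ∫⁻ z, ‖F z‖ₑ ^ q ∂quarterPlaneVolume ≠ ∞ := by
  have hlim : ∀ᵐ z ∂quarterPlaneVolume, Tendsto (fun i => ‖F' i z‖ₑ ^ q) atTop
      (𝓝 (‖F z‖ₑ ^ q)) := by
    filter_upwards [hF] with z hz
    exact (ENNReal.continuous_rpow_const.tendsto _).comp hz.enorm
  set b : ℝ≥0 × ℝ≥0 → ℝ≥0∞ := (square A n₀).indicator fun _ => ENNReal.ofReal M ^ q with hb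
  have hle : ∀ i z, ‖F' i z‖ₑ ^ q ≤ b z := fun i z => by
    by_cases hz : z ∈ square A n₀
    · rw [hb, Set.indicator_of_mem hz]
      refine ENNReal.rpow_le_rpow ?_ hq.le
      rw [← ofReal_norm]
      exact ENNReal.ofReal_le_ofReal (hF'M i z)
    · simp [hF's i z hz, hq]
  have hbfin : ∫⁻ z, b z ∂quarterPlaneVolume ≠ ∞ := by
    rw [hb, lintegral_indicator_const (measurableSet_square n₀)]
    exact ENNReal.mul_ne_top (ENNReal.rpow_ne_top_of_nonneg hq.le ENNReal.ofReal_ne_top)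
      (quarterPlaneVolume_square_ne_top n₀)
  refine ⟨tendsto_lintegral_of_dominated_convergence b (fun i => ?_) (fun i => ae_of_all _ (hle i))
    hbfin hlim, ne_top_of_le_ne_top hbfin (lintegral_mono_ae ?_)⟩
  · exact (hF'm i).enorm.pow_const q
  · filter_upwards [hlim] with z hz
    exact le_of_tendsto' hz fun i => hle i z

/-- Fatou's lemma on the left and dominated convergence on the right carry the bound over from step
functions. -/
theorem lintegral_variation_le (hd : 1 < Nat.card A) {p : ℝ} (hp : 2 ≤ p) {m : ℕ}
    {k : Fin (m + 1) → ℤ} (hk : Monotone k) {n₀ : ℕ} (hn : ∀ j, -(n₀ : ℤ) ≤ k j ∧ k j ≤ n₀)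
    {F G : ℝ≥0 × ℝ≥0 → ℂ} (hF : Measurable F) (hG : Measurable G) {M : ℝ}
    (hFM : ∀ z, ‖F z‖ ≤ M) (hGM : ∀ z, ‖G z‖ ≤ M)
    (hFs : ∀ z, z ∉ square A n₀ → F z = 0) (hGs : ∀ z, z ∉ square A n₀ → G z = 0) :
    ∑ j : Fin m, ∫⁻ z, ‖bilinearAverage e (k j.succ) F G z
        - bilinearAverage e (k j.castSucc) F G z‖ₑ ^ p ∂quarterPlaneVolume
      ≤ ENNReal.ofReal (2 ^ (p - 2) * 3)
        * (∫⁻ z, ‖F z‖ₑ ^ (2 * p) ∂quarterPlaneVolume) ^ (1 / 2 : ℝ)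
        * (∫⁻ z, ‖G z‖ₑ ^ (2 * p) ∂quarterPlaneVolume) ^ (1 / 2 : ℝ) := by
  have hp0 : 0 < p := by linarith
  obtain ⟨f, hfM, hfs, hfF⟩ := exists_stepFun_approximation e hd hF hFM hFs
  obtain ⟨g, hgM, hgs, hgG⟩ := exists_stepFun_approximation e hd hG hGM hGs
  -- Starting at scale `n₀` makes the bounds and the supports uniform in `i`.
  let F' : ℕ → ℝ≥0 × ℝ≥0 → ℂ := fun i => stepFun e (n₀ + i) (f (n₀ + i))
  let G' : ℕ → ℝ≥0 × ℝ≥0 → ℂ := fun i => stepFun e (n₀ + i) (g (n₀ + i))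
  have hshift : Tendsto (fun i => n₀ + i) atTop atTop := tendsto_atTop_mono
    (fun i => Nat.le_add_left i n₀) tendsto_id
  have hF'm : ∀ i, Measurable (F' i) := fun i => measurable_stepFun e _ _
  have hG'm : ∀ i, Measurable (G' i) := fun i => measurable_stepFun e _ _
  have hF'M : ∀ i z, ‖F' i z‖ ≤ M + M := fun i => hfM _ (Nat.le_add_right _ _)
  have hG'M : ∀ i z, ‖G' i z‖ ≤ M + M := fun i => hgM _ (Nat.le_add_right _ _)
  have hF's : ∀ i z, z ∉ square A n₀ → F' i z = 0 := fun i => hfs _ (Nat.le_add_right _ _)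
  have hG's : ∀ i z, z ∉ square A n₀ → G' i z = 0 := fun i => hgs _ (Nat.le_add_right _ _)
  have hF'F : ∀ᵐ z ∂quarterPlaneVolume, Tendsto (fun i => F' i z) atTop (𝓝 (F z)) := by
    filter_upwards [hfF] with z hz
    exact hz.comp hshift
  have hG'G : ∀ᵐ z ∂quarterPlaneVolume, Tendsto (fun i => G' i z) atTop (𝓝 (G z)) := by
    filter_upwards [hgG] with z hz
    exact hz.comp hshift
  have hki : ∀ i j, -((n₀ + i : ℕ) : ℤ) ≤ k j ∧ k j ≤ ((n₀ + i : ℕ) : ℤ) := fun i j => by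
    have := hn j
    push_cast
    omega
  have hlim : ∀ j, ∀ᵐ z ∂quarterPlaneVolume,
      Tendsto (fun i => bilinearAverage e (k j) (F' i) (G' i) z) atTop
        (𝓝 (bilinearAverage e (k j) F G z)) := fun j => by
    filter_upwards [ae_tendsto_bilinearAverage e hd (hn j).1 hF'm hG'm hF'M hG'M hF'F hG'G]
      with z hz
    by_cases hzs : z ∈ square A n₀
    · exact hz hzs
    · rw [bilinearAverage_eq_zero e hFs hGs _ hzs]
      refine tendsto_const_nhds.congr fun i => ?_
      rw [bilinearAverage_eq_zero e (hF's i) (hG's i) _ hzs]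
  let D : Fin m → ℝ≥0 × ℝ≥0 → ℝ≥0∞ := fun j z => ‖bilinearAverage e (k j.succ) F G z
        - bilinearAverage e (k j.castSucc) F G z‖ₑ ^ p
  let D' : ℕ → Fin m → ℝ≥0 × ℝ≥0 → ℝ≥0∞ := fun i j z =>
    ‖bilinearAverage e (k j.succ) (F' i) (G' i) z
      - bilinearAverage e (k j.castSucc) (F' i) (G' i) z‖ₑ ^ p
  have hD'm : ∀ i j, Measurable (D' i j) := fun i j =>
    ((measurable_bilinearAverage_stepFun e hd (hki i _).1 (hki i _).2 _ _).sub
      (measurable_bilinearAverage_stepFun e hd (hki i _).1 (hki i _).2 _ _)).enorm.pow_const p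
  have hDlim : ∀ j, ∀ᵐ z ∂quarterPlaneVolume, Tendsto (fun i => D' i j z) atTop (𝓝 (D j z)) :=
    fun j => by
      filter_upwards [hlim j.succ, hlim j.castSucc] with z h1 h2
      exact (ENNReal.continuous_rpow_const.tendsto _).comp (h1.sub h2).enorm
  -- Measurability for general `F` and `G` is inherited from the almost everywhere limit.
  have hDm : ∀ j, AEMeasurable (D j) quarterPlaneVolume := fun j =>
    aemeasurable_of_tendsto_metrizable_ae _ (fun i => (hD'm i j).aemeasurable) (hDlim j)
  have hsum : ∀ᵐ z ∂quarterPlaneVolume, Tendsto (fun i => ∑ j, D' i j z) atTop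
      (𝓝 (∑ j, D j z)) := by
    filter_upwards [ae_all_iff.2 hDlim] with z hz
    exact tendsto_finsetSum _ fun j _ => hz j
  obtain ⟨hFt, hFfin⟩ := tendsto_lintegral_enorm_rpow hF'm hF'M hF's hF'F
    (show 0 < 2 * p by positivity)
  obtain ⟨hGt, hGfin⟩ := tendsto_lintegral_enorm_rpow hG'm hG'M hG's hG'G
    (show 0 < 2 * p by positivity)
  have hhalf : (0 : ℝ) ≤ 1 / 2 := by norm_num
  have hFt' := (ENNReal.continuous_rpow_const (y := (1 / 2 : ℝ))).tendsto _ |>.comp hFt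
  have hGt' := (ENNReal.continuous_rpow_const (y := (1 / 2 : ℝ))).tendsto _ |>.comp hGt
  have hR := ENNReal.Tendsto.mul (ENNReal.Tendsto.const_mul hFt'
      (Or.inr (ENNReal.ofReal_ne_top (r := 2 ^ (p - 2) * 3))))
    (Or.inr (ENNReal.rpow_ne_top_of_nonneg hhalf hGfin)) hGt'
    (Or.inr (ENNReal.mul_ne_top ENNReal.ofReal_ne_top
      (ENNReal.rpow_ne_top_of_nonneg hhalf hFfin)))
  calc ∑ j, ∫⁻ z, D j z ∂quarterPlaneVolume
      = ∫⁻ z, ∑ j, D j z ∂quarterPlaneVolume := (lintegral_finsetSum' _ fun j _ => hDm j).symm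
    _ = ∫⁻ z, liminf (fun i => ∑ j, D' i j z) atTop ∂quarterPlaneVolume := by
        refine lintegral_congr_ae ?_
        filter_upwards [hsum] with z hz
        exact hz.liminf_eq.symm
    _ ≤ liminf (fun i => ∫⁻ z, ∑ j, D' i j z ∂quarterPlaneVolume) atTop :=
        lintegral_liminf_le fun i => Finset.measurable_fun_sum _ fun j _ => hD'm i j
    _ ≤ liminf (fun i => ENNReal.ofReal (2 ^ (p - 2) * 3)
        * (∫⁻ z, ‖F' i z‖ₑ ^ (2 * p) ∂quarterPlaneVolume) ^ (1 / 2 : ℝ)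
        * (∫⁻ z, ‖G' i z‖ₑ ^ (2 * p) ∂quarterPlaneVolume) ^ (1 / 2 : ℝ)) atTop := by
        refine liminf_le_liminf (Eventually.of_forall fun i => ?_)
        rw [lintegral_finsetSum _ fun j _ => hD'm i j]
        exact lintegral_variation_stepFun_le e hd hp hk (hki i) _ _
    _ = _ := hR.liminf_eq

lemma bilinearAverage_eq_of_card_eq_one (h : Nat.card A = 1) (k l : ℤ) (F G : ℝ≥0 × ℝ≥0 → ℂ) :
    bilinearAverage e k F G = bilinearAverage e l F G := by
  funext z
  simp only [bilinearAverage, h, Nat.cast_one, one_zpow]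

omit [AddCommGroup A] [Finite A] in
lemma exists_square_supset (hd : 1 < Nat.card A) {F : ℝ≥0 × ℝ≥0 → ℂ} {a b : ℝ≥0 × ℝ≥0}
    (h : Function.support F ⊆ Set.Icc a b) :
    ∃ n₁ : ℕ, ∀ n ≥ n₁, ∀ z, z ∉ square A n → F z = 0 := by
  have hd1 : (1 : ℝ≥0) < Nat.card A := by exact_mod_cast hd
  obtain ⟨n₁, hn₁⟩ := pow_unbounded_of_one_lt (max b.1 b.2) hd1
  refine ⟨n₁, fun n hn z hz => ?_⟩
  by_contra hne
  have hzb := (h hne).2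
  have hlt := hn₁.trans_le (pow_le_pow_right₀ hd1.le hn)
  exact hz ⟨(hzb.1.trans (le_max_left _ _)).trans_lt hlt,
    (hzb.2.trans (le_max_right _ _)).trans_lt hlt⟩

end CantorGroup

lemma eLpNorm_ofReal_rpow {q r : ℝ} (hq : 0 < q) (F : ℝ≥0 × ℝ≥0 → ℂ) :
    eLpNorm F (ENNReal.ofReal q) quarterPlaneVolume ^ r
      = (∫⁻ z, ‖F z‖ₑ ^ q ∂quarterPlaneVolume) ^ (r / q) := by
  rw [eLpNorm_eq_lintegral_rpow_enorm_toReal (by simpa using hq) ENNReal.ofReal_ne_top,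
    ENNReal.toReal_ofReal hq.le, ← ENNReal.rpow_mul]
  congr 1
  ring

end

theorem mainTheorem2 (p : ℝ) (hp : 2 ≤ p) :
    ∃ C : ℝ≥0, ∀ (A : Type*) [AddCommGroup A] [Finite A] (e : DigitLabelling A)
      (F G : ℝ≥0 × ℝ≥0 → ℂ),
      Measurable F → Measurable G →
      (∃ M : ℝ, ∀ z, ‖F z‖ ≤ M) → (∃ M : ℝ, ∀ z, ‖G z‖ ≤ M) →
      -- the supports lie in bounded rectangles `[a₁, b₁] × [a₂, b₂]`
      (∃ a b : ℝ≥0 × ℝ≥0, Function.support F ⊆ Set.Icc a b) →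
      (∃ a b : ℝ≥0 × ℝ≥0, Function.support G ⊆ Set.Icc a b) →
      ∀ (m : ℕ), 0 < m → ∀ k : Fin (m + 1) → ℤ, StrictMono k →
        ∑ j : Fin m,
          eLpNorm (CantorGroup.bilinearAverage e (k j.succ) F G
              - CantorGroup.bilinearAverage e (k j.castSucc) F G)
            (ENNReal.ofReal p) quarterPlaneVolume ^ p
        ≤ (C : ℝ≥0∞) * eLpNorm F (ENNReal.ofReal (2 * p)) quarterPlaneVolume ^ p
            * eLpNorm G (ENNReal.ofReal (2 * p)) quarterPlaneVolume ^ p := by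
  have hp0 : 0 < p := by linarith
  refine ⟨(2 ^ (p - 2) * 3 : ℝ).toNNReal, ?_⟩
  intro A _ _ e F G hF hG ⟨M₁, hM₁⟩ ⟨M₂, hM₂⟩ ⟨a, b, hFs⟩ ⟨a', b', hGs⟩ m _ k hk
  -- For the trivial group `d = 1`, the averages do not depend on `k` and all differences vanish.
  rcases (Nat.one_le_iff_ne_zero.mpr (Nat.card_pos (α := A)).ne').eq_or_lt with h | hd
  · refine (Finset.sum_eq_zero fun j _ => ?_).trans_le zero_le
    rw [CantorGroup.bilinearAverage_eq_of_card_eq_one e h.symm (k j.succ) (k j.castSucc), sub_self,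
      eLpNorm_zero, ENNReal.zero_rpow_of_pos hp0]
  obtain ⟨n₁, hn₁⟩ := CantorGroup.exists_square_supset hd hFs
  obtain ⟨n₂, hn₂⟩ := CantorGroup.exists_square_supset hd hGs
  -- One scale that contains both supports and bounds every `|k j|`.
  have hn : ∀ j, -((n₁ + n₂ + ∑ i, (k i).natAbs : ℕ) : ℤ) ≤ k j ∧
      k j ≤ ((n₁ + n₂ + ∑ i, (k i).natAbs : ℕ) : ℤ) := fun j => by
    have := Finset.single_le_sum (f := fun i => (k i).natAbs) (fun i _ => Nat.zero_le _)
      (Finset.mem_univ j)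
    omega
  have key := CantorGroup.lintegral_variation_le e hd hp hk.monotone hn hF hG
    (fun z => (hM₁ z).trans (le_max_left M₁ M₂)) (fun z => (hM₂ z).trans (le_max_right M₁ M₂))
    (hn₁ _ (by omega)) (hn₂ _ (by omega))
  have h2 : p / (2 * p) = 1 / 2 := by field_simp
  rw [eLpNorm_ofReal_rpow (by positivity), eLpNorm_ofReal_rpow (by positivity), h2]
  refine le_trans (le_of_eq (Finset.sum_congr rfl fun j _ => ?_)) key
  rw [eLpNorm_ofReal_rpow hp0, div_self hp0.ne', ENNReal.rpow_one]
  rfl
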